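/- Let $0<\alpha<\tfrac12$, $r>0$, $T>0$. For $a\le b$ let $W_1^\alpha(a,b)$ be the normed space of measurable $f:[a,b]\to\mathbb R$ with $$\|f\|_{\alpha,1}=\sup_{u\in[a,b]}\Big(|f(u)|+\int_a^u\frac{|f(u)-f(v)|}{(u-v)^{\alpha+1}}\,dv\Big)<\infty,$$ and let $W_2^{1-\alpha}(0,T)$ be the seminormed space of measurable $g:[0,T]\to\mathbb R$ with $$\|g\|_{1-\alpha,2}=\sup_{0\le u<v\le T}\Big(\frac{|g(v)-g(u)|}{(v-u)^{1-\alpha}}+\int_u^v\frac{|g(y)-g(u)|}{(y-u)^{2-\alpha}}\,dy\Big)<\infty.$$ For $f\in W_1^\alpha(0,T)$, $g\in W_2^{1-\alpha}(0,T)$ and $t\in[0,T]$, $\int_0^t f\,dg$ denotes the generalized Stieltjes integral $$\int_0^t f\,dg=(-1)^\alpha\int_0^t D^\alpha_{0+}f(s)\,D^{1-\alpha}_{t-}g_{t-}(s)\,ds,\qquad g_{t-}(s)=g(s)-g(t),$$ where $$D^{\alpha}_{0+}f(s)=\frac1{\Gamma(1-\alpha)}\Big(\frac{f(s)}{s^\alpha}+\alpha\int_0^s\frac{f(s)-f(u)}{(s-u)^{\alpha+1}}\,du\Big),$$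 $$D^{1-\alpha}_{t-}k(s)=\frac{(-1)^{1-\alpha}}{\Gamma(\alpha)}\Big(\frac{k(s)}{(t-s)^{1-\alpha}}+(1-\alpha)\int_s^t\frac{k(s)-k(u)}{(u-s)^{2-\alpha}}\,du\Big),$$ and $(-1)^\alpha(-1)^{1-\alpha}=-1$. Let $b,\sigma:\mathbb R\to\mathbb R$ be twice continuously differentiable with bounded first and second derivatives, let $\eta:[-r,0]\to\mathbb R$, and let $$W_2^{1-\alpha}(0,T)\to W_1^\alpha(-r,T-r),\qquad g\mapsto\bar x^g,$$ be continuously Fréchet differentiable, with derivative in the direction $h$ denoted by $D_h\bar x^g$. Then for every $g\in W_2^{1-\alpha}(0,T)$ the equation $$x^g_t=\eta_0+\int_0^t b(x^g_s)\,ds+\int_0^t\sigma(\bar x^g_{s-r})\,dg_s,\quad t\in[0,T],\qquad x^g_t=\eta_t,\quad t\in[-r,0],$$ has exactly one solution $x^g:[-r,T]\to\mathbb R$ whose restriction to $[0,T]$ lies in $W_1^\alpha(0,T)$. The map $g\mapsto x^g$ from $W_2^{1-\alpha}(0,T)$ to $W_1^\alpha(0,T)$ is Fréchet differentiable, and for all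 $g,h\in W_2^{1-\alpha}(0,T)$ its derivative $D_hx^g$ at $g$ in the direction $h$ satisfies, for all $t\in[0,T]$, $$D_hx^g_t=\int_0^t b'(x^g_s)\,D_hx^g_s\,ds+\int_0^t\sigma(\bar x^g_{s-r})\,dh_s+\int_0^t\sigma'(\bar x^g_{s-r})\,D_h\bar x^g_{s-r}\,dg_s.$$ -/

import Mathlib

open MeasureTheory Set
open scoped ENNReal

namespace FracDelay

noncomputable section

/-- The extended norm
`sup_{u ∈ [a,b]} ( |f(u)| + ∫_a^u |f(u) - f(v)| / (u - v)^(α+1) dv ) ∈ [0, ∞]`. -/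
def w1ENorm (α a b : ℝ) (f : ℝ → ℝ) : ℝ≥0∞ :=
  ⨆ u ∈ Icc a b,
    (‖f u‖ₑ + ∫⁻ v in Ioo a u, ‖f u - f v‖ₑ / ENNReal.ofReal ((u - v) ^ (α + 1)))

/-- The extended seminorm
`sup_{0 ≤ u < v ≤ T} ( |g(v) - g(u)| / (v-u)^(1-α) + ∫_u^v |g(y) - g(u)| / (y-u)^(2-α) dy )`. -/
def w2ENorm (α T : ℝ) (g : ℝ → ℝ) : ℝ≥0∞ :=
  ⨆ u ∈ Icc 0 T, ⨆ v ∈ Ioc u T,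
    (‖g v - g u‖ₑ / ENNReal.ofReal ((v - u) ^ (1 - α))
      + ∫⁻ y in Ioo u v, ‖g y - g u‖ₑ / ENNReal.ofReal ((y - u) ^ (2 - α)))

/-- Subadditivity of the integral terms that occur in both norms. -/
theorem lintegral_incr_add_le {s : Set ℝ} {k : ℝ → ℝ} (hk : Measurable k) {f g : ℝ → ℝ}
    (hf : AEMeasurable f (volume.restrict s)) (u : ℝ) :
    (∫⁻ v in s, ‖(f + g) u - (f + g) v‖ₑ / ENNReal.ofReal (k v)) ≤
      (∫⁻ v in s, ‖f u - f v‖ₑ / ENNReal.ofReal (k v))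
        + ∫⁻ v in s, ‖g u - g v‖ₑ / ENNReal.ofReal (k v) := by
  rw [← lintegral_add_left']
  · refine lintegral_mono fun v => ?_
    rw [← ENNReal.add_div]
    gcongr
    have : (f + g) u - (f + g) v = (f u - f v) + (g u - g v) := by
      simp only [Pi.add_apply]; ring
    rw [this]
    exact enorm_add_le _ _
  · exact ((aemeasurable_const.sub hf).enorm).div (hk.ennreal_ofReal.aemeasurable)

theorem lintegral_incr_smul {s : Set ℝ} {k : ℝ → ℝ} (c : ℝ) (f : ℝ → ℝ) (u : ℝ) :
    (∫⁻ v in s, ‖(c • f) u - (c • f) v‖ₑ / ENNReal.ofReal (k v)) =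
      ‖c‖ₑ * ∫⁻ v in s, ‖f u - f v‖ₑ / ENNReal.ofReal (k v) := by
  rw [← lintegral_const_mul' _ _ enorm_ne_top]
  refine lintegral_congr fun v => ?_
  rw [← mul_div_assoc, ← enorm_mul]
  simp only [Pi.smul_apply, smul_eq_mul, mul_sub]

theorem w1ENorm_add_le (α a b : ℝ) {f g : ℝ → ℝ}
    (hf : AEMeasurable f (volume.restrict (Icc a b))) :
    w1ENorm α a b (f + g) ≤ w1ENorm α a b f + w1ENorm α a b g := by
  refine iSup₂_le fun u hu => ?_
  have hf' : AEMeasurable f (volume.restrict (Ioo a u)) :=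
    hf.mono_measure (Measure.restrict_mono
      (show Ioo a u ⊆ Icc a b from fun x hx => ⟨hx.1.le, hx.2.le.trans hu.2⟩) le_rfl)
  have hk : Measurable fun v : ℝ => (u - v) ^ (α + 1) := by fun_prop
  have h1 := le_iSup₂ (f := fun u (_ : u ∈ Icc a b) => ‖f u‖ₑ +
    ∫⁻ v in Ioo a u, ‖f u - f v‖ₑ / ENNReal.ofReal ((u - v) ^ (α + 1))) u hu
  have h2 := le_iSup₂ (f := fun u (_ : u ∈ Icc a b) => ‖g u‖ₑ +
    ∫⁻ v in Ioo a u, ‖g u - g v‖ₑ / ENNReal.ofReal ((u - v) ^ (α + 1))) u hu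
  refine le_trans ?_ (add_le_add h1 h2)
  refine (add_le_add (enorm_add_le (f u) (g u)) (lintegral_incr_add_le hk hf' u)).trans ?_
  rw [add_add_add_comm]

theorem w1ENorm_smul (α a b c : ℝ) (f : ℝ → ℝ) :
    w1ENorm α a b (c • f) = ‖c‖ₑ * w1ENorm α a b f := by
  simp only [w1ENorm, ENNReal.mul_iSup, mul_add, lintegral_incr_smul]
  simp only [Pi.smul_apply, smul_eq_mul, enorm_mul]

theorem w2ENorm_eq (α T : ℝ) (g : ℝ → ℝ) : w2ENorm α T g =
    ⨆ u ∈ Icc 0 T, ⨆ v ∈ Ioc u T,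
    (‖g u - g v‖ₑ / ENNReal.ofReal ((v - u) ^ (1 - α))
      + ∫⁻ y in Ioo u v, ‖g u - g y‖ₑ / ENNReal.ofReal ((y - u) ^ (2 - α))) := by
  simp only [w2ENorm, enorm_sub_rev]

theorem w2ENorm_add_le (α T : ℝ) {f g : ℝ → ℝ}
    (hf : AEMeasurable f (volume.restrict (Icc 0 T))) :
    w2ENorm α T (f + g) ≤ w2ENorm α T f + w2ENorm α T g := by
  simp only [w2ENorm_eq]
  refine iSup₂_le fun u hu => iSup₂_le fun v hv => ?_
  have hf' : AEMeasurable f (volume.restrict (Ioo u v)) :=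
    hf.mono_measure (Measure.restrict_mono
      (show Ioo u v ⊆ Icc 0 T from fun x hx => ⟨hu.1.trans hx.1.le, hx.2.le.trans hv.2⟩) le_rfl)
  have hk : Measurable fun y : ℝ => (y - u) ^ (2 - α) := by fun_prop
  have key : ∀ q : ℝ → ℝ, (‖q u - q v‖ₑ / ENNReal.ofReal ((v - u) ^ (1 - α))
      + ∫⁻ y in Ioo u v, ‖q u - q y‖ₑ / ENNReal.ofReal ((y - u) ^ (2 - α))) ≤
      ⨆ u ∈ Icc 0 T, ⨆ v ∈ Ioc u T, (‖q u - q v‖ₑ / ENNReal.ofReal ((v - u) ^ (1 - α))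
      + ∫⁻ y in Ioo u v, ‖q u - q y‖ₑ / ENNReal.ofReal ((y - u) ^ (2 - α))) := fun q =>
    le_iSup₂_of_le u hu (le_iSup₂_of_le v hv le_rfl)
  refine le_trans ?_ (add_le_add (key f) (key g))
  have h0 : ‖(f + g) u - (f + g) v‖ₑ / ENNReal.ofReal ((v - u) ^ (1 - α)) ≤
      ‖f u - f v‖ₑ / ENNReal.ofReal ((v - u) ^ (1 - α)) +
      ‖g u - g v‖ₑ / ENNReal.ofReal ((v - u) ^ (1 - α)) := by
    rw [← ENNReal.add_div]
    gcongr
    have : (f + g) u - (f + g) v = (f u - f v) + (g u - g v) := by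
      simp only [Pi.add_apply]; ring
    rw [this]
    exact enorm_add_le _ _
  refine (add_le_add h0 (lintegral_incr_add_le hk hf' u)).trans ?_
  rw [add_add_add_comm]

theorem w2ENorm_smul (α T c : ℝ) (f : ℝ → ℝ) :
    w2ENorm α T (c • f) = ‖c‖ₑ * w2ENorm α T f := by
  simp only [w2ENorm_eq, ENNReal.mul_iSup, mul_add, lintegral_incr_smul]
  simp only [Pi.smul_apply, smul_eq_mul, ← mul_sub, enorm_mul, mul_div_assoc]

/-- Measurable functions on `[a,b]` with finite `w1ENorm`.  A function on `[a,b]` is represented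
by its extension by zero to `ℝ`; measurable means Lebesgue measurable on `[a,b]`. -/
def w1Submodule (α a b : ℝ) : Submodule ℝ (ℝ → ℝ) where
  carrier := {f | (∀ t, t ∉ Icc a b → f t = 0) ∧
    AEMeasurable f (volume.restrict (Icc a b)) ∧ w1ENorm α a b f < ∞}
  zero_mem' := ⟨fun _ _ => rfl, aemeasurable_const, by simp [w1ENorm]⟩
  add_mem' := fun {f g} hf hg => ⟨fun t ht => by simp [hf.1 t ht, hg.1 t ht],
    hf.2.1.add hg.2.1,
    (w1ENorm_add_le α a b hf.2.1).trans_lt (ENNReal.add_lt_top.2 ⟨hf.2.2, hg.2.2⟩)⟩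
  smul_mem' := fun c f hf => ⟨fun t ht => by simp [hf.1 t ht], hf.2.1.const_smul c, by
    rw [w1ENorm_smul]; exact ENNReal.mul_lt_top enorm_lt_top hf.2.2⟩

/-- Measurable functions on `[0,T]` (extended by zero to `ℝ`) with finite `w2ENorm`. -/
def w2Submodule (α T : ℝ) : Submodule ℝ (ℝ → ℝ) where
  carrier := {g | (∀ t, t ∉ Icc 0 T → g t = 0) ∧
    AEMeasurable g (volume.restrict (Icc 0 T)) ∧ w2ENorm α T g < ∞}
  zero_mem' := ⟨fun _ _ => rfl, aemeasurable_const, by simp [w2ENorm]⟩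
  add_mem' := fun {f g} hf hg => ⟨fun t ht => by simp [hf.1 t ht, hg.1 t ht],
    hf.2.1.add hg.2.1,
    (w2ENorm_add_le α T hf.2.1).trans_lt (ENNReal.add_lt_top.2 ⟨hf.2.2, hg.2.2⟩)⟩
  smul_mem' := fun c f hf => ⟨fun t ht => by simp [hf.1 t ht], hf.2.1.const_smul c, by
    rw [w2ENorm_smul]; exact ENNReal.mul_lt_top enorm_lt_top hf.2.2⟩

/-- The space `W_1^α(a,b)`. It is a separate type, so that it carries the topology of its norm
and not that of pointwise convergence. -/
def W1 (α a b : ℝ) : Type := w1Submodule α a b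

/-- The space `W_2^{1-α}(0,T)` (note that the parameter is `α`, not `1-α`). -/
def W2 (α T : ℝ) : Type := w2Submodule α T

instance (α a b : ℝ) : AddCommGroup (W1 α a b) :=
  inferInstanceAs (AddCommGroup (w1Submodule α a b))

instance (α a b : ℝ) : Module ℝ (W1 α a b) :=
  inferInstanceAs (Module ℝ (w1Submodule α a b))

instance (α T : ℝ) : AddCommGroup (W2 α T) :=
  inferInstanceAs (AddCommGroup (w2Submodule α T))

instance (α T : ℝ) : Module ℝ (W2 α T) :=
  inferInstanceAs (Module ℝ (w2Submodule α T))

instance (α a b : ℝ) : CoeFun (W1 α a b) (fun _ => ℝ → ℝ) := ⟨Subtype.val⟩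

instance (α T : ℝ) : CoeFun (W2 α T) (fun _ => ℝ → ℝ) := ⟨Subtype.val⟩

instance (α a b : ℝ) : Norm (W1 α a b) := ⟨fun f => (w1ENorm α a b f).toReal⟩

instance (α T : ℝ) : Norm (W2 α T) := ⟨fun g => (w2ENorm α T g).toReal⟩

theorem W1.core (α a b : ℝ) : NormedSpace.Core ℝ (W1 α a b) where
  norm_nonneg _ := ENNReal.toReal_nonneg
  norm_smul c f := by
    change (w1ENorm α a b (c • f.1)).toReal = ‖c‖ * (w1ENorm α a b f.1).toReal
    rw [w1ENorm_smul, ENNReal.toReal_mul, toReal_enorm]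
  norm_triangle f g := by
    change (w1ENorm α a b (f.1 + g.1)).toReal ≤
      (w1ENorm α a b f.1).toReal + (w1ENorm α a b g.1).toReal
    rw [← ENNReal.toReal_add f.2.2.2.ne g.2.2.2.ne]
    exact ENNReal.toReal_mono (ENNReal.add_lt_top.2 ⟨f.2.2.2, g.2.2.2⟩).ne
      (w1ENorm_add_le α a b f.2.2.1)
  norm_eq_zero_iff f := by
    change (w1ENorm α a b f.1).toReal = 0 ↔ f = 0
    constructor
    · intro h
      rcases (ENNReal.toReal_eq_zero_iff _).1 h with h | h
      · refine Subtype.ext (funext fun t => ?_)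
        change f.1 t = 0
        by_cases ht : t ∈ Icc a b
        · have h1 : w1ENorm α a b f.1 ≤ 0 := h.le
          have h2 := (iSup₂_le_iff.1 h1) t ht
          have h3 : ‖f.1 t‖ₑ ≤ 0 := le_self_add.trans h2
          simpa using h3
        · exact f.2.1 t ht
      · exact absurd h f.2.2.2.ne
    · rintro rfl
      change (w1ENorm α a b 0).toReal = 0
      simp [w1ENorm]

theorem W2.core (α T : ℝ) : SeminormedSpace.Core ℝ (W2 α T) where
  norm_nonneg _ := ENNReal.toReal_nonneg
  norm_smul c f := by
    change (w2ENorm α T (c • f.1)).toReal = ‖c‖ * (w2ENorm α T f.1).toReal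
    rw [w2ENorm_smul, ENNReal.toReal_mul, toReal_enorm]
  norm_triangle f g := by
    change (w2ENorm α T (f.1 + g.1)).toReal ≤
      (w2ENorm α T f.1).toReal + (w2ENorm α T g.1).toReal
    rw [← ENNReal.toReal_add f.2.2.2.ne g.2.2.2.ne]
    exact ENNReal.toReal_mono (ENNReal.add_lt_top.2 ⟨f.2.2.2, g.2.2.2⟩).ne
      (w2ENorm_add_le α T f.2.2.1)

instance (α a b : ℝ) : NormedAddCommGroup (W1 α a b) := NormedAddCommGroup.ofCore (W1.core α a b)

instance (α a b : ℝ) : NormedSpace ℝ (W1 α a b) := NormedSpace.ofCore (W1.core α a b)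

/-- `‖·‖_{1-α,2}` vanishes on constants, so this space is only seminormed. -/
instance (α T : ℝ) : SeminormedAddCommGroup (W2 α T) :=
  SeminormedAddCommGroup.ofCore (W2.core α T)

instance (α T : ℝ) : NormedSpace ℝ (W2 α T) where
  norm_smul_le c g := ((W2.core α T).norm_smul c g).le

/-- The left-sided fractional derivative `D_{a+}^α f (t)`. -/
def leftFracDeriv (α a : ℝ) (f : ℝ → ℝ) (t : ℝ) : ℝ :=
  1 / Real.Gamma (1 - α) *
    (f t / (t - a) ^ α + α * ∫ s in a..t, (f t - f s) / (t - s) ^ (α + 1))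

/-- The right-sided fractional derivative `D_{b-}^β f (t)` without its phase factor `(-1)^β`. -/
def rightFracDeriv (β b : ℝ) (f : ℝ → ℝ) (t : ℝ) : ℝ :=
  1 / Real.Gamma (1 - β) *
    (f t / (b - t) ^ β + β * ∫ s in t..b, (f t - f s) / (s - t) ^ (β + 1))

/-- The generalized Stieltjes integral
`∫_a^b f dg = (-1)^α ∫_a^b D_{a+}^α f(t) D_{b-}^{1-α} g_{b-}(t) dt`, `g_{b-} = g - g(b)`.
The two phase factors multiply to `(-1)^α (-1)^{1-α} = -1`. -/
def stieltjes (α a b : ℝ) (f g : ℝ → ℝ) : ℝ :=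
  -∫ t in a..b, leftFracDeriv α a f t * rightFracDeriv (1 - α) b (fun s => g s - g b) t

/-- `x : [-r,T] → ℝ` solves `x_t = η_0 + ∫_0^t b(x_s) ds + ∫_0^t σ(x̄_{s-r}) dg_s` on `[0,T]`,
`x_t = η_t` on `[-r,0]`, and `x` restricted to `[0,T]` lies in `W_1^α(0,T)`.
Values of `x` outside `[-r,T]` are irrelevant. -/
structure IsSolution (α r T : ℝ) (b σ η : ℝ → ℝ) (xbar : W1 α (-r) (T - r)) (g : W2 α T)
    (x : ℝ → ℝ) : Prop where
  mem : ∃ z : W1 α 0 T, EqOn z x (Icc 0 T)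
  init : ∀ t ∈ Icc (-r) 0, x t = η t
  eqn : ∀ t ∈ Icc 0 T, x t =
    η 0 + (∫ s in (0 : ℝ)..t, b (x s)) + stieltjes α 0 t (fun s => σ (xbar (s - r))) g

/-- `φ` is `k` times continuously differentiable and its derivatives of orders `1, …, k` are
bounded on `ℝ` (`φ` itself need not be bounded). -/
def IsCkb (k : ℕ) (φ : ℝ → ℝ) : Prop :=
  ContDiff ℝ k φ ∧ ∀ i : ℕ, 1 ≤ i → i ≤ k → ∃ C : ℝ, ∀ x, |iteratedDeriv i φ x| ≤ C

end

end FracDelay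

/-! The integrand `σ(x̄_{s-r})` does not involve the unknown, so the equation reads `V x = G(g)`,
where `V x = x - ∫ b(x)` does not see `g` and `G(g) = η 0 + ∫ σ(x̄^g_{s-r}) dg` is explicit. If `V`
is a bijection of `W1` with differentiable inverse `S`, then `x^g = S(G(g))`. Uniqueness is
injectivity of `V`, and the chain rule gives `V'(x^g)(D_h x^g) = G'(g) h`, which is the linear
equation claimed.

Differentiability of `G` needs two facts. The Stieltjes integral is a bounded bilinear map from `W1
× W2` to `W1` (`stieltjesCLM`): `|D^α f(u)|` is at most a multiple of `‖f‖ u^(-α)`, the right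
derivatives of `g` are bounded and vary with the endpoint `t` in a Hölder way
(`abs_rightFracDerivSub_sub_le`), so the integral is `(1-α)`-Hölder in `t`
(`abs_singular_integral_sub_le`), and such functions lie in `W1` because `1 - α > α`. Moreover `f ↦
σ ∘ f` is differentiable on `W1` (`hasFDerivAt_nemytskii`), by bounds on the increments of the
Taylor remainder.

Invertibility of `V` rests on integration turning sup bounds into `W1` bounds. Gronwall's inequality
in the sup norm thus makes the inverse Lipschitz on `W1` (`IsSuperposition.norm_sub_le`), and a
contraction in a weighted sup norm gives surjectivity. The same argument inverts the derivative of
`V`, so the inverse is differentiable (`exists_volterra_inverse`); completeness of `W1` is never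
used. -/

namespace FracDelay

/-! ### Power kernels, and passage between Lebesgue and interval integrals -/

section Kernels

theorem enorm_div_ofReal {k : ℝ} (hk : 0 < k) (x : ℝ) :
    ‖x‖ₑ / ENNReal.ofReal k = ‖x / k‖ₑ := by
  rw [← ofReal_norm, ← ofReal_norm, norm_div, Real.norm_of_nonneg hk.le,
    ENNReal.ofReal_div_of_pos hk]

theorem intervalIntegrable_sub_left_rpow {p : ℝ} (hp : -1 < p) (s t c : ℝ) :
    IntervalIntegrable (fun v => (c - v) ^ p) volume s t := by
  have h := (intervalIntegral.intervalIntegrable_rpow' hp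
    (a := c - s) (b := c - t)).comp_sub_left c
  simpa using h

theorem intervalIntegrable_sub_right_rpow {p : ℝ} (hp : -1 < p) (s t c : ℝ) :
    IntervalIntegrable (fun v => (v - c) ^ p) volume s t := by
  have h := (intervalIntegral.intervalIntegrable_rpow' hp
    (a := s - c) (b := t - c)).comp_sub_right c
  simpa using h

theorem integral_sub_left_rpow {p : ℝ} (hp : -1 < p) (s t : ℝ) :
    ∫ v in s..t, (t - v) ^ p = (t - s) ^ (p + 1) / (p + 1) := by
  rw [intervalIntegral.integral_comp_sub_left (fun x => x ^ p), integral_rpow (Or.inl hp),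
    sub_self, Real.zero_rpow (by linarith), sub_zero]

theorem integral_sub_right_rpow {p : ℝ} (hp : -1 < p) (s t : ℝ) :
    ∫ v in s..t, (v - s) ^ p = (t - s) ^ (p + 1) / (p + 1) := by
  rw [intervalIntegral.integral_comp_sub_right (fun x => x ^ p), integral_rpow (Or.inl hp),
    sub_self, Real.zero_rpow (by linarith), sub_zero]

theorem setLIntegral_enorm_le {F B : ℝ → ℝ} {s t : ℝ} (hst : s ≤ t)
    (hB : IntervalIntegrable B volume s t) (h : ∀ v ∈ Ioo s t, |F v| ≤ B v) :
    ∫⁻ v in Ioo s t, ‖F v‖ₑ ≤ ENNReal.ofReal (∫ v in s..t, B v) := by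
  have hB' : Integrable B (volume.restrict (Ioo s t)) :=
    ((intervalIntegrable_iff_integrableOn_Ioo_of_le hst).1 hB)
  rw [intervalIntegral.integral_of_le hst, integral_Ioc_eq_integral_Ioo,
    ofReal_integral_eq_lintegral_ofReal hB'
      ((ae_restrict_iff' measurableSet_Ioo).2 (Filter.Eventually.of_forall fun v hv =>
        (abs_nonneg _).trans (h v hv)))]
  refine setLIntegral_mono' measurableSet_Ioo fun v hv => ?_
  rw [← ofReal_norm]
  exact ENNReal.ofReal_le_ofReal (h v hv)

theorem integral_abs_le_of_setLIntegral {F : ℝ → ℝ} {s t : ℝ} (hst : s ≤ t)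
    (hm : AEStronglyMeasurable F (volume.restrict (Ioo s t)))
    (hfin : ∫⁻ v in Ioo s t, ‖F v‖ₑ ≠ ∞) :
    IntervalIntegrable F volume s t ∧
      ENNReal.ofReal (∫ v in s..t, |F v|) = ∫⁻ v in Ioo s t, ‖F v‖ₑ := by
  have hi : Integrable F (volume.restrict (Ioo s t)) := ⟨hm, lt_top_iff_ne_top.2 hfin⟩
  refine ⟨(intervalIntegrable_iff_integrableOn_Ioo_of_le hst).2 hi, ?_⟩
  rw [intervalIntegral.integral_of_le hst, integral_Ioc_eq_integral_Ioo]
  exact ofReal_integral_norm_eq_lintegral_enorm hi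

end Kernels

/-! ### Estimates in `W_1^α` -/

section W1

variable {α a b : ℝ}

theorem w1_incr_eq (α a : ℝ) (f : ℝ → ℝ) (u : ℝ) :
    ∫⁻ v in Ioo a u, ‖f u - f v‖ₑ / ENNReal.ofReal ((u - v) ^ (α + 1)) =
      ∫⁻ v in Ioo a u, ‖(f u - f v) / (u - v) ^ (α + 1)‖ₑ :=
  setLIntegral_congr_fun measurableSet_Ioo fun _ hv =>
    enorm_div_ofReal (Real.rpow_pos_of_pos (sub_pos.2 hv.2) _) _

theorem w1ENorm_congr {f g : ℝ → ℝ} (h : EqOn f g (Icc a b)) :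
    w1ENorm α a b f = w1ENorm α a b g := by
  refine iSup_congr fun u => iSup_congr fun hu => ?_
  rw [h hu]
  congr 1
  refine setLIntegral_congr_fun measurableSet_Ioo fun v hv => ?_
  rw [h ⟨hv.1.le, hv.2.le.trans hu.2⟩]

/-- The element of `W1` represented by a function on `[a, b]`. -/
noncomputable def W1.ofFun (F : ℝ → ℝ) (hm : AEMeasurable F (volume.restrict (Icc a b)))
    (hF : w1ENorm α a b F < ∞) : W1 α a b :=
  ⟨indicator (Icc a b) F, fun _ ht => indicator_of_notMem ht _,
    hm.indicator measurableSet_Icc, by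
      rwa [w1ENorm_congr (g := F) fun t ht => indicator_of_mem ht F]⟩

theorem W1.ofFun_apply {F : ℝ → ℝ} (hm : AEMeasurable F (volume.restrict (Icc a b)))
    (hF : w1ENorm α a b F < ∞) {t : ℝ} (ht : t ∈ Icc a b) : W1.ofFun F hm hF t = F t :=
  indicator_of_mem ht F

theorem W1.norm_le (f : W1 α a b) {F : ℝ → ℝ} {C : ℝ} (hC : 0 ≤ C) (h : EqOn f F (Icc a b))
    (hF : w1ENorm α a b F ≤ ENNReal.ofReal C) : ‖f‖ ≤ C := by
  change (w1ENorm α a b f.1).toReal ≤ C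
  rw [w1ENorm_congr h]
  exact ENNReal.toReal_le_of_le_ofReal hC hF

theorem W1.w1ENorm_eq (f : W1 α a b) : w1ENorm α a b f = ENNReal.ofReal ‖f‖ :=
  (ENNReal.ofReal_toReal f.2.2.2.ne).symm

theorem W1.ext {f g : W1 α a b} (h : EqOn f g (Icc a b)) : f = g := by
  refine Subtype.ext (funext fun t => ?_)
  by_cases ht : t ∈ Icc a b
  · exact h ht
  · rw [f.2.1 t ht, g.2.1 t ht]

theorem W1.add_apply (f g : W1 α a b) (t : ℝ) : (f + g) t = f t + g t := rfl
theorem W1.sub_apply (f g : W1 α a b) (t : ℝ) : (f - g) t = f t - g t := rfl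
theorem W1.smul_apply (c : ℝ) (f : W1 α a b) (t : ℝ) : (c • f) t = c * f t := rfl

theorem W1.aemeasurable (f : W1 α a b) {u : ℝ} (hu : u ≤ b) :
    AEMeasurable f (volume.restrict (Ioo a u)) :=
  f.2.2.1.mono_measure (Measure.restrict_mono
    (show Ioo a u ⊆ Icc a b from fun _ hx => ⟨hx.1.le, hx.2.le.trans hu⟩) le_rfl)

theorem W1.aemeasurable_incr (f : W1 α a b) {u : ℝ} (hu : u ≤ b) :
    AEMeasurable (fun v => (f u - f v) / (u - v) ^ (α + 1)) (volume.restrict (Ioo a u)) :=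
  (aemeasurable_const.sub (f.aemeasurable hu)).div
    (by fun_prop : Measurable fun v : ℝ => (u - v) ^ (α + 1)).aemeasurable

theorem W1.enorm_le (f : W1 α a b) {u : ℝ} (hu : u ∈ Icc a b) :
    ‖f u‖ₑ + ∫⁻ v in Ioo a u, ‖f u - f v‖ₑ / ENNReal.ofReal ((u - v) ^ (α + 1)) ≤
      ENNReal.ofReal ‖f‖ := by
  rw [← f.w1ENorm_eq]
  exact le_iSup₂ (f := fun u (_ : u ∈ Icc a b) => ‖f u‖ₑ +
    ∫⁻ v in Ioo a u, ‖f u - f v‖ₑ / ENNReal.ofReal ((u - v) ^ (α + 1))) u hu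

theorem W1.intervalIntegrable_and_le (f : W1 α a b) {u : ℝ} (hu : u ∈ Icc a b) :
    IntervalIntegrable (fun v => (f u - f v) / (u - v) ^ (α + 1)) volume a u ∧
    |f u| + ∫ v in a..u, |(f u - f v) / (u - v) ^ (α + 1)| ≤ ‖f‖ := by
  have h := f.enorm_le hu
  rw [w1_incr_eq] at h
  have hfin := ne_top_of_le_ne_top ENNReal.ofReal_ne_top (le_add_self.trans h)
  obtain ⟨hi, he⟩ := integral_abs_le_of_setLIntegral hu.1
    (f.aemeasurable_incr hu.2).aestronglyMeasurable hfin
  refine ⟨hi, ?_⟩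
  rw [← he, ← ofReal_norm, ← ENNReal.ofReal_add (norm_nonneg _)
    (intervalIntegral.integral_nonneg hu.1 fun _ _ => abs_nonneg _)] at h
  exact (ENNReal.ofReal_le_ofReal_iff (norm_nonneg f)).1 h

theorem W1.intervalIntegrable_incr (f : W1 α a b) {u : ℝ} (hu : u ∈ Icc a b) :
    IntervalIntegrable (fun v => (f u - f v) / (u - v) ^ (α + 1)) volume a u :=
  (f.intervalIntegrable_and_le hu).1

theorem W1.abs_apply_le (f : W1 α a b) (u : ℝ) : |f u| ≤ ‖f‖ := by
  by_cases hu : u ∈ Icc a b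
  · have := (f.intervalIntegrable_and_le hu).2
    have h0 : 0 ≤ ∫ v in a..u, |(f u - f v) / (u - v) ^ (α + 1)| :=
      intervalIntegral.integral_nonneg hu.1 fun _ _ => abs_nonneg _
    linarith
  · rw [f.2.1 u hu, abs_zero]; exact norm_nonneg f

theorem W1.abs_integral_incr_le (f : W1 α a b) {u : ℝ} (hu : u ∈ Icc a b) :
    |∫ v in a..u, (f u - f v) / (u - v) ^ (α + 1)| ≤ ‖f‖ := by
  have h := (f.intervalIntegrable_and_le hu).2
  have h1 := intervalIntegral.abs_integral_le_integral_abs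
    (f := fun v => (f u - f v) / (u - v) ^ (α + 1)) (μ := volume) hu.1
  have h2 := abs_nonneg (f u)
  linarith

/-- The seminorm part is monotone in the increments, so a scalar inequality between increments is
enough. Two dominating functions are allowed because `φ'(f) k` and the Taylor remainder vary through
both `f` and `k`. -/
theorem w1ENorm_le_of_dominated {F : ℝ → ℝ} {M c₁ c₂ : ℝ} (f h : W1 α a b)
    (hc₁ : 0 ≤ c₁) (hc₂ : 0 ≤ c₂) (hM0 : 0 ≤ M) (hM : ∀ u ∈ Icc a b, |F u| ≤ M)
    (hF : ∀ u ∈ Icc a b, ∀ v ∈ Icc a b, |F u - F v| ≤ c₁ * |f u - f v| + c₂ * |h u - h v|) :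
    w1ENorm α a b F ≤ ENNReal.ofReal (M + c₁ * ‖f‖ + c₂ * ‖h‖) := by
  refine iSup₂_le fun u hu => ?_
  have hf := f.intervalIntegrable_and_le hu
  have hh := h.intervalIntegrable_and_le hu
  rw [w1_incr_eq]
  have key := setLIntegral_enorm_le (F := fun v => (F u - F v) / (u - v) ^ (α + 1)) hu.1
    ((hf.1.abs.const_mul c₁).add (hh.1.abs.const_mul c₂)) fun v hv => by
      have hp : 0 < (u - v) ^ (α + 1) := Real.rpow_pos_of_pos (sub_pos.2 hv.2) _
      rw [abs_div, abs_div, abs_div, abs_of_pos hp, ← mul_div_assoc, ← mul_div_assoc, ← add_div]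
      gcongr
      exact hF u hu v ⟨hv.1.le, hv.2.le.trans hu.2⟩
  have h0 : ‖F u‖ₑ ≤ ENNReal.ofReal M := by
    rw [← ofReal_norm]; exact ENNReal.ofReal_le_ofReal (hM u hu)
  refine (add_le_add h0 key).trans ?_
  rw [intervalIntegral.integral_add (hf.1.abs.const_mul c₁) (hh.1.abs.const_mul c₂),
    intervalIntegral.integral_const_mul, intervalIntegral.integral_const_mul]
  have h1 : 0 ≤ ∫ v in a..u, |(f u - f v) / (u - v) ^ (α + 1)| :=
    intervalIntegral.integral_nonneg hu.1 fun _ _ => abs_nonneg _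
  have h2 : 0 ≤ ∫ v in a..u, |(h u - h v) / (u - v) ^ (α + 1)| :=
    intervalIntegral.integral_nonneg hu.1 fun _ _ => abs_nonneg _
  rw [← ENNReal.ofReal_add hM0 (by positivity), add_assoc]
  have h3 := abs_nonneg (f u)
  have h4 := abs_nonneg (h u)
  gcongr <;> linarith

/-- The integrand is at most `C (u - v)^((1-α) - (α+1)) = C (u - v)^(-2α)`, which is integrable
because `α < 1/2`. -/
theorem w1ENorm_le_of_holder (hα : α < 1 / 2) {F : ℝ → ℝ} {M C : ℝ}
    (hM0 : 0 ≤ M) (hC : 0 ≤ C) (hM : ∀ u ∈ Icc a b, |F u| ≤ M)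
    (hF : ∀ u ∈ Icc a b, ∀ v ∈ Ico a u, |F u - F v| ≤ C * (u - v) ^ (1 - α)) :
    w1ENorm α a b F ≤ ENNReal.ofReal (M + C * ((b - a) ^ (1 - 2 * α) / (1 - 2 * α))) := by
  have hα' : 0 < 1 - 2 * α := by linarith
  refine iSup₂_le fun u hu => ?_
  rw [w1_incr_eq]
  have key := setLIntegral_enorm_le (F := fun v => (F u - F v) / (u - v) ^ (α + 1)) hu.1
    ((intervalIntegrable_sub_left_rpow (p := -(2 * α)) (by linarith) a u u).const_mul C)
    fun v hv => by
      have hp : 0 < u - v := sub_pos.2 hv.2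
      rw [abs_div, abs_of_pos (Real.rpow_pos_of_pos hp _), div_le_iff₀ (Real.rpow_pos_of_pos hp _),
        mul_assoc, ← Real.rpow_add hp, show -(2 * α) + (α + 1) = 1 - α by ring]
      exact hF u hu v ⟨hv.1.le, hv.2⟩
  have h0 : ‖F u‖ₑ ≤ ENNReal.ofReal M := by
    rw [← ofReal_norm]; exact ENNReal.ofReal_le_ofReal (hM u hu)
  refine (add_le_add h0 key).trans ?_
  rw [intervalIntegral.integral_const_mul, integral_sub_left_rpow (by linarith),
    show -(2 * α) + 1 = 1 - 2 * α by ring]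
  have h1 : 0 ≤ u - a := sub_nonneg.2 hu.1
  rw [← ENNReal.ofReal_add hM0 (by positivity)]
  gcongr
  exact hu.2

end W1

/-! ### Estimates in `W_2^{1-α}` -/

section W2

variable {α T : ℝ}

theorem W2.aemeasurable (g : W2 α T) {u v : ℝ} (hu : 0 ≤ u) (hv : v ≤ T) :
    AEMeasurable g (volume.restrict (Ioo u v)) :=
  g.2.2.1.mono_measure (Measure.restrict_mono
    (show Ioo u v ⊆ Icc 0 T from fun _ hx => ⟨hu.trans hx.1.le, hx.2.le.trans hv⟩) le_rfl)

theorem W2.intervalIntegrable_and_le (g : W2 α T) {u v : ℝ} (hu : 0 ≤ u) (huv : u < v)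
    (hv : v ≤ T) :
    IntervalIntegrable (fun y => (g u - g y) / (y - u) ^ (2 - α)) volume u v ∧
    |g u - g v| / (v - u) ^ (1 - α) + ∫ y in u..v, |(g u - g y) / (y - u) ^ (2 - α)| ≤ ‖g‖ := by
  have h : ‖g u - g v‖ₑ / ENNReal.ofReal ((v - u) ^ (1 - α))
      + ∫⁻ y in Ioo u v, ‖g u - g y‖ₑ / ENNReal.ofReal ((y - u) ^ (2 - α)) ≤
      ENNReal.ofReal ‖g‖ := by
    have : ENNReal.ofReal ‖g‖ = w2ENorm α T g := ENNReal.ofReal_toReal g.2.2.2.ne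
    rw [this, w2ENorm_eq]
    exact le_iSup₂_of_le u ⟨hu, huv.le.trans hv⟩ (le_iSup₂_of_le v ⟨huv, hv⟩ le_rfl)
  have hp : 0 < (v - u) ^ (1 - α) := Real.rpow_pos_of_pos (sub_pos.2 huv) _
  rw [enorm_div_ofReal hp,
    setLIntegral_congr_fun (g := fun y => ‖(g u - g y) / (y - u) ^ (2 - α)‖ₑ)
      measurableSet_Ioo fun y hy =>
      enorm_div_ofReal (Real.rpow_pos_of_pos (sub_pos.2 hy.1) _) _] at h
  have hfin := ne_top_of_le_ne_top ENNReal.ofReal_ne_top (le_add_self.trans h)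
  obtain ⟨hi, he⟩ := integral_abs_le_of_setLIntegral
    (F := fun y => (g u - g y) / (y - u) ^ (2 - α)) huv.le
    ((aemeasurable_const.sub (g.aemeasurable hu hv)).div
    (by fun_prop : Measurable fun y : ℝ => (y - u) ^ (2 - α)).aemeasurable).aestronglyMeasurable
    hfin
  refine ⟨hi, ?_⟩
  rw [← he, ← ofReal_norm, ← ENNReal.ofReal_add (norm_nonneg _)
    (intervalIntegral.integral_nonneg huv.le fun _ _ => abs_nonneg _),
    norm_div, Real.norm_of_nonneg hp.le] at h
  exact (ENNReal.ofReal_le_ofReal_iff (norm_nonneg g)).1 h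

theorem W2.abs_sub_le (g : W2 α T) {u v : ℝ} (hu : 0 ≤ u) (huv : u < v) (hv : v ≤ T) :
    |g u - g v| ≤ ‖g‖ * (v - u) ^ (1 - α) := by
  have h := (g.intervalIntegrable_and_le hu huv hv).2
  have h0 : 0 ≤ ∫ y in u..v, |(g u - g y) / (y - u) ^ (2 - α)| :=
    intervalIntegral.integral_nonneg huv.le fun _ _ => abs_nonneg _
  rw [← div_le_iff₀ (Real.rpow_pos_of_pos (sub_pos.2 huv) _)]
  linarith

end W2

/-! ### Measurability of the integral terms in the fractional derivatives -/

section Measurability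

/-- For a Borel version of `f` the integrand is jointly measurable, so its integral over `v` is
measurable in `u`. Since the slices of `D` stay inside `S`, replacing `f` by that version changes
the integral only for a null set of `u`. -/
theorem aestronglyMeasurable_integral_incr {S : Set ℝ} (hS : MeasurableSet S) {f : ℝ → ℝ}
    (hf : AEMeasurable f (volume.restrict S)) {D : Set (ℝ × ℝ)} (hD : MeasurableSet D)
    {k : ℝ × ℝ → ℝ} (hk : Measurable k) (hDS : ∀ u ∈ S, ∀ v, (u, v) ∈ D → v ∈ S) :
    AEStronglyMeasurable (fun u => ∫ v in {v | (u, v) ∈ D}, (f u - f v) / k (u, v))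
      (volume.restrict S) := by
  set f' := hf.mk f
  have hf' : Measurable f' := hf.measurable_mk
  have hm : Measurable (D.indicator fun q : ℝ × ℝ => (f' q.1 - f' q.2) / k q) :=
    (((hf'.comp measurable_fst).sub (hf'.comp measurable_snd)).div hk).indicator hD
  have hH : StronglyMeasurable
      (fun u => ∫ v, D.indicator (fun q : ℝ × ℝ => (f' q.1 - f' q.2) / k q) (u, v)) :=
    hm.stronglyMeasurable.integral_prod_right'
  refine hH.aestronglyMeasurable.congr ?_
  have hae := hf.ae_eq_mk
  filter_upwards [hae, ae_restrict_mem hS] with u hu huS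
  have hDu : MeasurableSet {v | (u, v) ∈ D} := measurable_prodMk_left hD
  have h1 : (fun v => D.indicator (fun q : ℝ × ℝ => (f' q.1 - f' q.2) / k q) (u, v)) =
      {v | (u, v) ∈ D}.indicator (fun v => (f' u - f' v) / k (u, v)) := by
    funext v; rfl
  rw [h1, integral_indicator hDu]
  refine setIntegral_congr_ae hDu ?_
  filter_upwards [(ae_restrict_iff' hS).1 hae] with v hv hvD
  rw [hv (hDS u huS v hvD), hu]

end Measurability

/-! ### A Beta-type integral -/

section Beta

/-- On each half of `(0, s)` only one factor is singular; the other is at most its value at `s / 2`.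
-/
theorem rpow_mul_rpow_le_add {α s u : ℝ} (h0 : 0 < α) (h1 : α < 1) (hu : 0 < u) (hus : u < s) :
    u ^ (-α) * (s - u) ^ (α - 1) ≤
      u ^ (-α) * (s / 2) ^ (α - 1) + (s / 2) ^ (-α) * (s - u) ^ (α - 1) := by
  have hs : 0 < s / 2 := by linarith
  have hsu : 0 < s - u := sub_pos.2 hus
  rcases le_total u (s / 2) with h | h
  · have : (s - u) ^ (α - 1) ≤ (s / 2) ^ (α - 1) :=
      Real.rpow_le_rpow_of_nonpos hs (by linarith) (by linarith)
    have h2 : u ^ (-α) * (s - u) ^ (α - 1) ≤ u ^ (-α) * (s / 2) ^ (α - 1) := by gcongr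
    have h3 : 0 ≤ (s / 2) ^ (-α) * (s - u) ^ (α - 1) := by positivity
    linarith
  · have : u ^ (-α) ≤ (s / 2) ^ (-α) :=
      Real.rpow_le_rpow_of_nonpos hs h (by linarith)
    have h2 : u ^ (-α) * (s - u) ^ (α - 1) ≤ (s / 2) ^ (-α) * (s - u) ^ (α - 1) := by gcongr
    have h3 : 0 ≤ u ^ (-α) * (s / 2) ^ (α - 1) := by positivity
    linarith

/-- The exponents `-α` and `α - 1` add up to `-1`, so the integral is scale invariant: it equals
`2^(1-α)/(1-α) + 2^α/α` for every `s`. -/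
theorem integral_beta_majorant_le {α s : ℝ} (h0 : 0 < α) (h1 : α < 1) (hs : 0 < s) :
    IntervalIntegrable (fun u => u ^ (-α) * (s / 2) ^ (α - 1) +
      (s / 2) ^ (-α) * (s - u) ^ (α - 1)) volume 0 s ∧
    ∫ u in (0 : ℝ)..s, (u ^ (-α) * (s / 2) ^ (α - 1) + (s / 2) ^ (-α) * (s - u) ^ (α - 1)) ≤
      2 / (1 - α) + 2 / α := by
  have i1 : IntervalIntegrable (fun u : ℝ => u ^ (-α) * (s / 2) ^ (α - 1)) volume 0 s :=
    (intervalIntegral.intervalIntegrable_rpow' (by linarith)).mul_const _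
  have i2 : IntervalIntegrable (fun u : ℝ => (s / 2) ^ (-α) * (s - u) ^ (α - 1)) volume 0 s :=
    (intervalIntegrable_sub_left_rpow (by linarith) 0 s s).const_mul _
  refine ⟨i1.add i2, ?_⟩
  rw [intervalIntegral.integral_add i1 i2, intervalIntegral.integral_mul_const,
    intervalIntegral.integral_const_mul, integral_sub_left_rpow (by linarith),
    integral_rpow (Or.inl (by linarith)), Real.zero_rpow (by linarith)]
  have e1 : (s ^ (-α + 1) - 0) / (-α + 1) * (s / 2) ^ (α - 1) = 2 ^ (1 - α) / (1 - α) := by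
    rw [Real.div_rpow hs.le zero_le_two, show α - 1 = -(1 - α) by ring,
      show -α + 1 = 1 - α by ring, Real.rpow_neg hs.le, Real.rpow_neg zero_le_two]
    have := Real.rpow_pos_of_pos hs (1 - α)
    have h2 := Real.rpow_pos_of_pos (zero_lt_two (α := ℝ)) (1 - α)
    have : 1 - α ≠ 0 := by linarith
    field_simp
    ring
  have e2 : (s / 2) ^ (-α) * ((s - 0) ^ (α - 1 + 1) / (α - 1 + 1)) = 2 ^ α / α := by
    rw [Real.div_rpow hs.le zero_le_two, Real.rpow_neg hs.le, Real.rpow_neg zero_le_two,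
      show α - 1 + 1 = α by ring, sub_zero]
    have := Real.rpow_pos_of_pos hs α
    have h2 := Real.rpow_pos_of_pos (zero_lt_two (α := ℝ)) α
    field_simp
  rw [e1, e2]
  have p1 : (2 : ℝ) ^ (1 - α) ≤ 2 := by
    simpa using Real.rpow_le_rpow_of_exponent_le (x := (2 : ℝ)) one_le_two
      (show 1 - α ≤ 1 by linarith)
  have p2 : (2 : ℝ) ^ α ≤ 2 := by
    simpa using Real.rpow_le_rpow_of_exponent_le (x := (2 : ℝ)) one_le_two h1.le
  have : 0 < 1 - α := by linarith
  gcongr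

end Beta

/-! ### Hölder continuity of integrals with a singular factor -/

section SingularIntegral

variable {α T a q : ℝ} {A : ℝ → ℝ} {Q : ℝ → ℝ → ℝ}

theorem intervalIntegrable_mul_of_le (h1 : α < 1) {s t : ℝ} (hst : s ≤ t)
    {B : ℝ → ℝ} (hAm : AEStronglyMeasurable A (volume.restrict (Ioo s t)))
    (hBm : AEStronglyMeasurable B (volume.restrict (Ioo s t)))
    (hA : ∀ u ∈ Ioo s t, |A u| ≤ a * u ^ (-α)) (hB : ∀ u ∈ Ioo s t, |B u| ≤ q) :
    IntervalIntegrable (fun u => A u * B u) volume s t := by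
  rw [intervalIntegrable_iff_integrableOn_Ioo_of_le hst]
  have hi : IntervalIntegrable (fun u : ℝ => a * u ^ (-α) * q) volume s t :=
    ((intervalIntegral.intervalIntegrable_rpow' (by linarith)).const_mul a).mul_const q
  rw [intervalIntegrable_iff_integrableOn_Ioo_of_le hst] at hi
  refine hi.mono' (hAm.mul hBm) ?_
  filter_upwards [ae_restrict_mem measurableSet_Ioo] with u hu
  rw [Real.norm_eq_abs, abs_mul]
  have := hA u hu
  exact mul_le_mul this (hB u hu) (abs_nonneg _) ((abs_nonneg _).trans this)

theorem ae_mem_Ioc_of_mem_Ioo {s t : ℝ} {p : ℝ → Prop} (h : ∀ u ∈ Ioo s t, p u) :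
    ∀ᵐ u, u ∈ Ioc s t → p u := by
  filter_upwards [Measure.ae_ne volume t] with u hut hu
  exact h u ⟨hu.1, lt_of_le_of_ne hu.2 hut⟩

/-- The difference is `∫_s^t A Q_t + ∫_0^s A (Q_t - Q_s)`. In the first term `u^(-α) ≤ (u - s)^(-α)`
yields `(t - s)^(1-α)/(1-α)`. In the second the factor `(t - s)^(1-α)` comes out and the Beta-type
integral remains, adding `2/(1-α) + 2/α`. -/
theorem abs_singular_integral_sub_le (h0 : 0 < α) (h1 : α < 1) (ha : 0 ≤ a) (hq : 0 ≤ q)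
    (hAm : AEStronglyMeasurable A (volume.restrict (Icc 0 T)))
    (hQm : ∀ t ∈ Icc 0 T, AEStronglyMeasurable (Q t) (volume.restrict (Icc 0 t)))
    (hA : ∀ u ∈ Ioc 0 T, |A u| ≤ a * u ^ (-α))
    (hQ : ∀ t ∈ Icc 0 T, ∀ u ∈ Ico 0 t, |Q t u| ≤ q)
    (hQQ : ∀ t ∈ Icc 0 T, ∀ s ∈ Ioo 0 t, ∀ u ∈ Ioo 0 s,
      |Q t u - Q s u| ≤ q * (t - s) ^ (1 - α) * (s - u) ^ (α - 1))
    {s t : ℝ} (hs : 0 ≤ s) (hst : s < t) (ht : t ≤ T) :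
    |(∫ u in (0 : ℝ)..t, A u * Q t u) - ∫ u in (0 : ℝ)..s, A u * Q s u| ≤
      (3 / (1 - α) + 2 / α) * (a * q) * (t - s) ^ (1 - α) := by
  have h1' : 0 < 1 - α := by linarith
  have ht0 : 0 ≤ t := hs.trans hst.le
  have hmono : ∀ {x y : ℝ}, 0 ≤ x → y ≤ T → Ioo x y ⊆ Icc 0 T :=
    fun hx hy w hw => ⟨hx.trans hw.1.le, hw.2.le.trans hy⟩
  have ii : ∀ {x y z : ℝ}, 0 ≤ x → x ≤ y → y ≤ z → z ≤ T →
      IntervalIntegrable (fun u => A u * Q z u) volume x y := fun {x y z} hx hxy hyz hz =>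
    intervalIntegrable_mul_of_le h1 hxy
      (hAm.mono_measure (Measure.restrict_mono (hmono hx (hyz.trans hz)) le_rfl))
      ((hQm z ⟨hx.trans (hxy.trans hyz), hz⟩).mono_measure (Measure.restrict_mono
        (show Ioo x y ⊆ Icc 0 z from
          fun w hw => ⟨hx.trans hw.1.le, hw.2.le.trans hyz⟩) le_rfl))
      (fun u hu => hA u ⟨hx.trans_lt hu.1, hu.2.le.trans (hyz.trans hz)⟩)
      (fun u hu => hQ z ⟨hx.trans (hxy.trans hyz), hz⟩ u
        ⟨hx.trans hu.1.le, hu.2.trans_le hyz⟩)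
  have split : (∫ u in (0 : ℝ)..t, A u * Q t u) - (∫ u in (0 : ℝ)..s, A u * Q s u) =
      (∫ u in s..t, A u * Q t u) + ∫ u in (0 : ℝ)..s, (A u * Q t u - A u * Q s u) := by
    rw [intervalIntegral.integral_sub (ii le_rfl hs hst.le ht)
      (ii le_rfl hs le_rfl (hst.le.trans ht)),
      ← intervalIntegral.integral_add_adjacent_intervals (ii le_rfl hs hst.le ht)
      (ii hs hst.le le_rfl ht)]
    ring
  have b1 : |∫ u in s..t, A u * Q t u| ≤ a * q * ((t - s) ^ (1 - α) / (1 - α)) := by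
    have h := intervalIntegral.norm_integral_le_of_norm_le (f := fun u => A u * Q t u)
      (g := fun u => a * q * (u - s) ^ (-α)) (μ := volume) hst.le
      (ae_mem_Ioc_of_mem_Ioo fun u hu => by
        have hu0 : 0 < u - s := sub_pos.2 hu.1
        rw [Real.norm_eq_abs, abs_mul]
        have e1 := hA u ⟨hs.trans_lt hu.1, hu.2.le.trans ht⟩
        have e2 : u ^ (-α) ≤ (u - s) ^ (-α) :=
          Real.rpow_le_rpow_of_nonpos hu0 (by linarith) (by linarith)
        have e3 := hQ t ⟨ht0, ht⟩ u ⟨hs.trans hu.1.le, hu.2⟩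
        calc |A u| * |Q t u| ≤ a * (u - s) ^ (-α) * q := by
              gcongr
              exact e1.trans (by gcongr)
          _ = _ := by ring)
      ((intervalIntegrable_sub_right_rpow (by linarith) s t s).const_mul _)
    rwa [intervalIntegral.integral_const_mul, integral_sub_right_rpow (by linarith),
      show -α + 1 = 1 - α by ring, Real.norm_eq_abs] at h
  have b2 : |∫ u in (0 : ℝ)..s, (A u * Q t u - A u * Q s u)| ≤
      a * q * (t - s) ^ (1 - α) * (2 / (1 - α) + 2 / α) := by
    have hts : 0 ≤ t - s := sub_nonneg.2 hst.le
    rcases hs.eq_or_lt with rfl | hs'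
    · rw [intervalIntegral.integral_same, abs_zero]
      positivity
    obtain ⟨hi, hle⟩ := integral_beta_majorant_le h0 h1 hs'
    have h := intervalIntegral.norm_integral_le_of_norm_le
      (f := fun u => A u * Q t u - A u * Q s u) (μ := volume) hs
      (ae_mem_Ioc_of_mem_Ioo fun u hu => by
        have e1 := hA u ⟨hu.1, hu.2.le.trans (hst.le.trans ht)⟩
        have e2 := hQQ t ⟨ht0, ht⟩ s ⟨hs', hst⟩ u hu
        have e3 := rpow_mul_rpow_le_add h0 h1 hu.1 hu.2
        have e4 : 0 < u ^ (-α) := Real.rpow_pos_of_pos hu.1 _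
        rw [← mul_sub, Real.norm_eq_abs, abs_mul]
        calc |A u| * |Q t u - Q s u|
            ≤ (a * u ^ (-α)) * (q * (t - s) ^ (1 - α) * (s - u) ^ (α - 1)) := by gcongr
          _ = a * q * (t - s) ^ (1 - α) * (u ^ (-α) * (s - u) ^ (α - 1)) := by ring
          _ ≤ _ := mul_le_mul_of_nonneg_left e3 (by positivity))
      (hi.const_mul (a * q * (t - s) ^ (1 - α)))
    rw [intervalIntegral.integral_const_mul, Real.norm_eq_abs] at h
    exact h.trans (mul_le_mul_of_nonneg_left hle (by positivity))
  rw [split]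
  refine (abs_add_le _ _).trans ((add_le_add b1 b2).trans (le_of_eq ?_))
  have : 1 - α ≠ 0 := h1'.ne'
  field_simp
  ring

end SingularIntegral

/-! ### Continuity and measurability of Hölder functions -/

section Holder

variable {a b β C : ℝ} {F : ℝ → ℝ}

theorem continuousOn_of_holder (hβ : 0 < β)
    (hF : ∀ u ∈ Icc a b, ∀ v ∈ Ico a u, |F u - F v| ≤ C * (u - v) ^ β) :
    ContinuousOn F (Icc a b) := by
  have key : ∀ u ∈ Icc a b, ∀ v ∈ Icc a b, |F v - F u| ≤ C * |v - u| ^ β := by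
    intro u hu v hv
    rcases lt_trichotomy u v with h | rfl | h
    · rw [abs_of_pos (sub_pos.2 h)]
      exact hF v hv u ⟨hu.1, h⟩
    · simp [Real.zero_rpow hβ.ne']
    · rw [abs_sub_comm, abs_sub_comm v, abs_of_pos (sub_pos.2 h)]
      exact hF u hu v ⟨hv.1, h⟩
  intro u hu
  rw [ContinuousWithinAt, tendsto_iff_norm_sub_tendsto_zero]
  have h1 : Filter.Tendsto (fun v => C * |v - u| ^ β) (nhdsWithin u (Icc a b)) (nhds 0) := by
    have : Continuous fun v : ℝ => C * |v - u| ^ β :=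
      continuous_const.mul ((continuous_id.sub continuous_const).abs.rpow_const
        fun _ => Or.inr hβ.le)
    have h2 := this.tendsto u
    simp only [sub_self, abs_zero, Real.zero_rpow hβ.ne', mul_zero] at h2
    exact h2.mono_left nhdsWithin_le_nhds
  exact squeeze_zero' (Filter.Eventually.of_forall fun _ => norm_nonneg _)
    (Filter.eventually_of_mem self_mem_nhdsWithin fun v hv => key u hu v hv) h1

theorem aemeasurable_of_holder (hβ : 0 < β)
    (hF : ∀ u ∈ Icc a b, ∀ v ∈ Ico a u, |F u - F v| ≤ C * (u - v) ^ β) :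
    AEMeasurable F (volume.restrict (Icc a b)) :=
  (continuousOn_of_holder hβ hF).aemeasurable measurableSet_Icc

end Holder

/-! ### The left-sided fractional derivative of `f` -/

section LeftDerivative

variable {α T : ℝ}

theorem leftFracDeriv_congr {f g : ℝ → ℝ} {u : ℝ} (hu : 0 < u) (h : EqOn f g (Ioc 0 u)) :
    leftFracDeriv α 0 f u = leftFracDeriv α 0 g u := by
  rw [leftFracDeriv, leftFracDeriv, h ⟨hu, le_rfl⟩]
  congr 3
  refine intervalIntegral.integral_congr_ae (Filter.Eventually.of_forall fun v hv => ?_)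
  rw [uIoc_of_le hu.le] at hv
  rw [h hv]

theorem stieltjes_congr {f f' : ℝ → ℝ} (g : ℝ → ℝ) {t : ℝ} (ht : 0 ≤ t)
    (h : EqOn f f' (Ioc 0 t)) : stieltjes α 0 t f g = stieltjes α 0 t f' g := by
  rw [stieltjes, stieltjes]
  congr 1
  refine intervalIntegral.integral_congr_ae (Filter.Eventually.of_forall fun u hu => ?_)
  rw [uIoc_of_le ht] at hu
  rw [leftFracDeriv_congr hu.1 (h.mono (Ioc_subset_Ioc_right hu.2))]

theorem leftFracDeriv_add (f g : W1 α 0 T) {u : ℝ} (hu : u ∈ Icc 0 T) :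
    leftFracDeriv α 0 (f + g) u = leftFracDeriv α 0 f u + leftFracDeriv α 0 g u := by
  simp only [leftFracDeriv, Pi.add_apply]
  have : ∫ v in (0 : ℝ)..u, (f u + g u - (f v + g v)) / (u - v) ^ (α + 1) =
      (∫ v in (0 : ℝ)..u, (f u - f v) / (u - v) ^ (α + 1)) +
        ∫ v in (0 : ℝ)..u, (g u - g v) / (u - v) ^ (α + 1) := by
    rw [← intervalIntegral.integral_add (f.intervalIntegrable_incr hu)
      (g.intervalIntegrable_incr hu)]
    congr 1 with v
    ring
  rw [this]
  ring

theorem leftFracDeriv_smul (c : ℝ) (f : W1 α 0 T) (u : ℝ) :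
    leftFracDeriv α 0 (c • f) u = c * leftFracDeriv α 0 f u := by
  simp only [leftFracDeriv, Pi.smul_apply, smul_eq_mul]
  have : ∫ v in (0 : ℝ)..u, (c * f u - c * f v) / (u - v) ^ (α + 1) =
      c * ∫ v in (0 : ℝ)..u, (f u - f v) / (u - v) ^ (α + 1) := by
    rw [← intervalIntegral.integral_const_mul]
    congr 1 with v
    ring
  rw [this]
  ring

theorem aestronglyMeasurable_leftFracDeriv (f : W1 α 0 T) :
    AEStronglyMeasurable (leftFracDeriv α 0 f) (volume.restrict (Icc 0 T)) := by
  have hD : MeasurableSet {q : ℝ × ℝ | 0 < q.2 ∧ q.2 ≤ q.1} :=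
    (measurableSet_lt measurable_const measurable_snd).inter
      (measurableSet_le measurable_snd measurable_fst)
  have h := aestronglyMeasurable_integral_incr measurableSet_Icc f.2.2.1 hD
    (k := fun q => (q.1 - q.2) ^ (α + 1)) (by fun_prop)
    fun u hu v hv => ⟨hv.1.le, hv.2.trans hu.2⟩
  have h' : AEStronglyMeasurable (fun u => ∫ v in (0 : ℝ)..u, (f u - f v) / (u - v) ^ (α + 1))
      (volume.restrict (Icc 0 T)) := by
    refine h.congr ?_
    filter_upwards [ae_restrict_mem measurableSet_Icc] with u hu
    rw [intervalIntegral.integral_of_le hu.1]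
    rfl
  unfold leftFracDeriv
  exact ((f.2.2.1.div (by fun_prop : Measurable fun t : ℝ => (t - 0) ^ α).aemeasurable
    ).aestronglyMeasurable.add (h'.const_mul α)).const_mul _

/-- The integral term is bounded by `‖f‖`, which is absorbed into the singular term through `1 ≤ T^α
u^(-α)`. -/
theorem abs_leftFracDeriv_le (hα : α ∈ Ioo (0 : ℝ) 1) (f : W1 α 0 T) {u : ℝ}
    (hu : u ∈ Ioc 0 T) :
    |leftFracDeriv α 0 f u| ≤ (1 + T ^ α) / Real.Gamma (1 - α) * ‖f‖ * u ^ (-α) := by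
  have hΓ : 0 < Real.Gamma (1 - α) := Real.Gamma_pos_of_pos (by linarith [hα.2])
  have hp : 0 < u ^ α := Real.rpow_pos_of_pos hu.1 _
  have h1 := f.abs_apply_le u
  have h2 := f.abs_integral_incr_le ⟨hu.1.le, hu.2⟩
  have h3 : u ^ α ≤ T ^ α := Real.rpow_le_rpow hu.1.le hu.2 hα.1.le
  rw [leftFracDeriv, abs_mul, abs_of_pos (by positivity), sub_zero, Real.rpow_neg hu.1.le]
  have h4 : |f u / u ^ α + α * ∫ s in (0 : ℝ)..u, (f u - f s) / (u - s) ^ (α + 1)| ≤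
      ‖f‖ / u ^ α + ‖f‖ := by
    refine (abs_add_le _ _).trans ?_
    rw [abs_div, abs_mul, abs_of_pos hp, abs_of_pos hα.1]
    have h5 : α * |∫ s in (0 : ℝ)..u, (f u - f s) / (u - s) ^ (α + 1)| ≤ 1 * ‖f‖ :=
      mul_le_mul hα.2.le h2 (abs_nonneg _) zero_le_one
    rw [one_mul] at h5
    gcongr
  have h6 : ‖f‖ / u ^ α + ‖f‖ ≤ (1 + T ^ α) * ‖f‖ * (u ^ α)⁻¹ := by
    rw [← div_eq_mul_inv, le_div_iff₀ hp, add_mul, div_mul_cancel₀ _ hp.ne', add_mul, one_mul,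
      mul_comm (T ^ α)]
    have := norm_nonneg f
    gcongr
  calc 1 / Real.Gamma (1 - α) *
        |f u / u ^ α + α * ∫ s in (0 : ℝ)..u, (f u - f s) / (u - s) ^ (α + 1)|
      ≤ 1 / Real.Gamma (1 - α) * ((1 + T ^ α) * ‖f‖ * (u ^ α)⁻¹) := by
        gcongr
        exact h4.trans h6
    _ = _ := by ring

end LeftDerivative

/-! ### The right-sided fractional derivative of `g` and its dependence on the endpoint -/

section RightDerivative

variable {α T : ℝ}

/-- The right-sided fractional derivative `D_{t-}^{1-α} g_{t-}(u)` without its phase factor. -/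
noncomputable def rightFracDerivSub (α : ℝ) (g : ℝ → ℝ) (t u : ℝ) : ℝ :=
  rightFracDeriv (1 - α) t (fun s => g s - g t) u

theorem rightFracDerivSub_eq (α : ℝ) (g : ℝ → ℝ) (t u : ℝ) :
    rightFracDerivSub α g t u = 1 / Real.Gamma α * ((g u - g t) / (t - u) ^ (1 - α) +
      (1 - α) * ∫ y in u..t, (g u - g y) / (y - u) ^ (2 - α)) := by
  simp only [rightFracDerivSub, rightFracDeriv, sub_sub_cancel, sub_sub_sub_cancel_right,
    show 1 - α + 1 = 2 - α by ring]

theorem rightFracDerivSub_self (α : ℝ) (g : ℝ → ℝ) (t : ℝ) : rightFracDerivSub α g t t = 0 := by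
  simp [rightFracDerivSub_eq]

theorem rightFracDerivSub_add (g h : W2 α T) {t u : ℝ} (hu : 0 ≤ u) (hut : u ≤ t) (ht : t ≤ T) :
    rightFracDerivSub α (g + h) t u = rightFracDerivSub α g t u + rightFracDerivSub α h t u := by
  rcases hut.eq_or_lt with rfl | hut
  · simp [rightFracDerivSub_self]
  simp only [rightFracDerivSub_eq, Pi.add_apply]
  have : ∫ y in u..t, (g u + h u - (g y + h y)) / (y - u) ^ (2 - α) =
      (∫ y in u..t, (g u - g y) / (y - u) ^ (2 - α)) +
        ∫ y in u..t, (h u - h y) / (y - u) ^ (2 - α) := by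
    rw [← intervalIntegral.integral_add (g.intervalIntegrable_and_le hu hut ht).1
      (h.intervalIntegrable_and_le hu hut ht).1]
    congr 1 with v
    ring
  rw [this]
  ring

theorem rightFracDerivSub_smul (c : ℝ) (g : W2 α T) (t u : ℝ) :
    rightFracDerivSub α (c • g) t u = c * rightFracDerivSub α g t u := by
  simp only [rightFracDerivSub_eq, Pi.smul_apply, smul_eq_mul]
  have : ∫ y in u..t, (c * g u - c * g y) / (y - u) ^ (2 - α) =
      c * ∫ y in u..t, (g u - g y) / (y - u) ^ (2 - α) := by
    rw [← intervalIntegral.integral_const_mul]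
    congr 1 with v
    ring
  rw [this]
  ring

theorem aestronglyMeasurable_rightFracDerivSub (g : W2 α T) {t : ℝ} (ht : t ≤ T) :
    AEStronglyMeasurable (rightFracDerivSub α g t) (volume.restrict (Icc 0 t)) := by
  have hg : AEMeasurable g (volume.restrict (Icc 0 t)) :=
    g.2.2.1.mono_measure (Measure.restrict_mono (Icc_subset_Icc_right ht) le_rfl)
  have hD : MeasurableSet {q : ℝ × ℝ | q.1 < q.2 ∧ q.2 ≤ t} :=
    (measurableSet_lt measurable_fst measurable_snd).inter
      (measurableSet_le measurable_snd measurable_const)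
  have h := aestronglyMeasurable_integral_incr measurableSet_Icc hg hD
    (k := fun q => (q.2 - q.1) ^ (2 - α)) (by fun_prop)
    fun u hu v hv => ⟨hu.1.trans hv.1.le, hv.2⟩
  have h' : AEStronglyMeasurable (fun u => ∫ y in u..t, (g u - g y) / (y - u) ^ (2 - α))
      (volume.restrict (Icc 0 t)) := by
    refine h.congr ?_
    filter_upwards [ae_restrict_mem measurableSet_Icc] with u hu
    rw [intervalIntegral.integral_of_le hu.2]
    rfl
  rw [show rightFracDerivSub α g t = _ from funext (rightFracDerivSub_eq α g t)]
  exact (((hg.sub_const _).div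
    (by fun_prop : Measurable fun u : ℝ => (t - u) ^ (1 - α)).aemeasurable
    ).aestronglyMeasurable.add (h'.const_mul _)).const_mul _

theorem abs_rightFracDerivSub_le (hα : α ∈ Ioo (0 : ℝ) 1) (g : W2 α T) {t u : ℝ} (hu : 0 ≤ u)
    (hut : u < t) (ht : t ≤ T) : |rightFracDerivSub α g t u| ≤ 1 / Real.Gamma α * ‖g‖ := by
  have hΓ : 0 < Real.Gamma α := Real.Gamma_pos_of_pos hα.1
  have hp : 0 < (t - u) ^ (1 - α) := Real.rpow_pos_of_pos (sub_pos.2 hut) _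
  rw [rightFracDerivSub_eq, abs_mul, abs_of_pos (by positivity)]
  have h1 := (g.intervalIntegrable_and_le hu hut ht).2
  have h2 := intervalIntegral.abs_integral_le_integral_abs
    (f := fun y => (g u - g y) / (y - u) ^ (2 - α)) (μ := volume) hut.le
  gcongr
  refine (abs_add_le _ _).trans ?_
  rw [abs_div, abs_mul, abs_of_pos hp, abs_of_pos (by linarith [hα.2] : 0 < 1 - α)]
  have h3 := mul_le_of_le_one_left
    (abs_nonneg (∫ y in u..t, (g u - g y) / (y - u) ^ (2 - α))) (by linarith [hα.1] : 1 - α ≤ 1)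
  linarith

/-- On `[s, t]` write `g u - g y = (g u - g s) + (g s - g y)`. Since `(1-α) ∫_s^t (y-u)^(α-2) dy =
(s-u)^(α-1) - (t-u)^(α-1)`, all multiples of `g u - g s` cancel. Only increments of `g` over `[s,
t]` remain, and they are small with `t - s`. -/
theorem rightFracDerivSub_sub_eq (hα : α ∈ Ioo (0 : ℝ) 1) (g : W2 α T) {s t u : ℝ} (hu : 0 ≤ u)
    (hus : u < s) (hst : s < t) (ht : t ≤ T) :
    IntervalIntegrable (fun y => (g s - g y) / (y - u) ^ (2 - α)) volume s t ∧
    rightFracDerivSub α g t u - rightFracDerivSub α g s u =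
      1 / Real.Gamma α * ((g s - g t) / (t - u) ^ (1 - α) +
        (1 - α) * ∫ y in s..t, (g s - g y) / (y - u) ^ (2 - α)) := by
  have hut := hus.trans hst
  have i1 := (g.intervalIntegrable_and_le hu hus (hst.le.trans ht)).1
  have i2 : IntervalIntegrable (fun y => (g u - g y) / (y - u) ^ (2 - α)) volume s t :=
    (g.intervalIntegrable_and_le hu hut ht).1.mono_set (by
      rw [uIcc_of_le hst.le, uIcc_of_le hut.le]
      exact Icc_subset_Icc_left hus.le)
  -- As `u < s`, the nonintegrable singularity at `y = u` lies outside `[s, t]`.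
  have h0 : (0 : ℝ) ∉ uIcc (s - u) (t - u) := by
    rw [uIcc_of_le (by linarith)]
    intro h
    linarith [h.1]
  have i3 : IntervalIntegrable (fun y => (y - u) ^ (-(2 - α))) volume s t := by
    have := (intervalIntegral.intervalIntegrable_rpow (μ := volume) (r := -(2 - α))
      (Or.inr h0)).comp_sub_right u
    simpa using this
  have heq : ∀ y ∈ Ioc s t, (g s - g y) / (y - u) ^ (2 - α) =
      (g u - g y) / (y - u) ^ (2 - α) - (g u - g s) * (y - u) ^ (-(2 - α)) := by
    intro y hy
    rw [Real.rpow_neg (by linarith [hy.1])]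
    ring
  have i4 : IntervalIntegrable (fun y => (g s - g y) / (y - u) ^ (2 - α)) volume s t := by
    refine (i2.sub (i3.const_mul (g u - g s))).congr ?_
    intro y hy
    rw [uIoc_of_le hst.le] at hy
    exact (heq y hy).symm
  refine ⟨i4, ?_⟩
  have e1 : ∫ y in s..t, (g s - g y) / (y - u) ^ (2 - α) =
      (∫ y in s..t, (g u - g y) / (y - u) ^ (2 - α)) -
        (g u - g s) * ∫ y in s..t, (y - u) ^ (-(2 - α)) := by
    rw [← intervalIntegral.integral_const_mul,
      ← intervalIntegral.integral_sub i2 (i3.const_mul _)]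
    refine intervalIntegral.integral_congr_ae (Filter.Eventually.of_forall fun y hy => ?_)
    rw [uIoc_of_le hst.le] at hy
    exact heq y hy
  have e2 : (1 - α) * ∫ y in s..t, (y - u) ^ (-(2 - α)) =
      1 / (s - u) ^ (1 - α) - 1 / (t - u) ^ (1 - α) := by
    have hα2 : 1 - α ≠ 0 := by linarith [hα.2]
    rw [intervalIntegral.integral_comp_sub_right (fun x => x ^ (-(2 - α))),
      integral_rpow (Or.inr ⟨by linarith [hα.2], h0⟩), show -(2 - α) + 1 = -(1 - α) by ring,
      Real.rpow_neg (by linarith), Real.rpow_neg (by linarith)]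
    field_simp
    ring
  rw [rightFracDerivSub_eq, rightFracDerivSub_eq, e1,
    ← intervalIntegral.integral_add_adjacent_intervals i1 i2]
  linear_combination (1 / Real.Gamma α * (g u - g s)) * e2

theorem abs_rightFracDerivSub_sub_le (hα : α ∈ Ioo (0 : ℝ) 1) (g : W2 α T) {s t u : ℝ}
    (hu : 0 ≤ u) (hus : u < s) (hst : s < t) (ht : t ≤ T) :
    |rightFracDerivSub α g t u - rightFracDerivSub α g s u| ≤
      2 / Real.Gamma α * ‖g‖ * (t - s) ^ (1 - α) * (s - u) ^ (α - 1) := by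
  obtain ⟨_, he⟩ := rightFracDerivSub_sub_eq hα g hu hus hst ht
  have hΓ : 0 < Real.Gamma α := Real.Gamma_pos_of_pos hα.1
  have hα1 : 0 < 1 - α := by linarith [hα.2]
  have hs0 : 0 ≤ s := hu.trans hus.le
  have hsu : 0 < s - u := sub_pos.2 hus
  have hts : 0 < t - s := sub_pos.2 hst
  have hp : 0 < (t - u) ^ (1 - α) := Real.rpow_pos_of_pos (by linarith) _
  have hp' : 0 < (s - u) ^ (1 - α) := Real.rpow_pos_of_pos hsu _
  have b1 : |(g s - g t) / (t - u) ^ (1 - α)| ≤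
      ‖g‖ * (t - s) ^ (1 - α) * (s - u) ^ (α - 1) := by
    rw [abs_div, abs_of_pos hp, show α - 1 = -(1 - α) by ring, Real.rpow_neg hsu.le,
      ← div_eq_mul_inv]
    have := g.abs_sub_le hs0 hst ht
    have : (s - u) ^ (1 - α) ≤ (t - u) ^ (1 - α) :=
      Real.rpow_le_rpow hsu.le (by linarith) hα1.le
    have : 0 ≤ ‖g‖ * (t - s) ^ (1 - α) := by positivity
    gcongr
  have b2 : |∫ y in s..t, (g s - g y) / (y - u) ^ (2 - α)| ≤
      ‖g‖ * (s - u) ^ (α - 1) * ((t - s) ^ (1 - α) / (1 - α)) := by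
    have h := intervalIntegral.norm_integral_le_of_norm_le
      (f := fun y => (g s - g y) / (y - u) ^ (2 - α))
      (g := fun y => ‖g‖ * (s - u) ^ (α - 1) * (y - s) ^ (-α)) (μ := volume) hst.le
      (ae_mem_Ioc_of_mem_Ioo fun y hy => by
        have hys : 0 < y - s := sub_pos.2 hy.1
        have hyu : 0 < y - u := by linarith
        have k1 := g.abs_sub_le hs0 hy.1 (hy.2.le.trans ht)
        -- One power of `y - u` is traded for `y - s`, which the Hölder bound on `g` reduces to the
        -- integrable `(y - s)^(-α)`; the rest is traded for `s - u`.
        have k2 : (y - s) * (s - u) ^ (1 - α) ≤ (y - u) ^ (2 - α) := by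
          rw [show 2 - α = 1 + (1 - α) by ring, Real.rpow_add hyu, Real.rpow_one]
          have : (s - u) ^ (1 - α) ≤ (y - u) ^ (1 - α) :=
            Real.rpow_le_rpow hsu.le (by linarith) hα1.le
          gcongr
        have k3 : 0 < (y - u) ^ (2 - α) := Real.rpow_pos_of_pos hyu _
        rw [Real.norm_eq_abs, abs_div, abs_of_pos k3]
        calc |g s - g y| / (y - u) ^ (2 - α)
            ≤ ‖g‖ * (y - s) ^ (1 - α) / ((y - s) * (s - u) ^ (1 - α)) := by gcongr
          _ = _ := by
              rw [show 1 - α = 1 + -α by ring, Real.rpow_add hys, Real.rpow_one,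
                show α - 1 = -(1 + -α) by ring, Real.rpow_neg hsu.le]
              field_simp)
      ((intervalIntegrable_sub_right_rpow (by linarith [hα.2]) s t s).const_mul _)
    rwa [intervalIntegral.integral_const_mul, integral_sub_right_rpow (by linarith [hα.2]),
      show -α + 1 = 1 - α by ring, Real.norm_eq_abs] at h
  have b3 : |(1 - α) * ∫ y in s..t, (g s - g y) / (y - u) ^ (2 - α)| ≤
      ‖g‖ * (t - s) ^ (1 - α) * (s - u) ^ (α - 1) := by
    rw [abs_mul, abs_of_pos hα1]
    calc _ ≤ (1 - α) * (‖g‖ * (s - u) ^ (α - 1) * ((t - s) ^ (1 - α) / (1 - α))) := by gcongr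
      _ = _ := by field_simp
  rw [he, abs_mul, abs_of_pos (by positivity)]
  calc _ ≤ 1 / Real.Gamma α * (‖g‖ * (t - s) ^ (1 - α) * (s - u) ^ (α - 1) +
        ‖g‖ * (t - s) ^ (1 - α) * (s - u) ^ (α - 1)) := by
        gcongr
        exact (abs_add_le _ _).trans (add_le_add b1 b3)
    _ = _ := by ring

end RightDerivative

/-! ### The generalized Stieltjes integral as a bounded bilinear map -/

section Stieltjes

variable {α T : ℝ}

theorem stieltjes_eq (α t : ℝ) (f g : ℝ → ℝ) : stieltjes α 0 t f g =
    -∫ u in (0 : ℝ)..t, leftFracDeriv α 0 f u * rightFracDerivSub α g t u := rfl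

theorem stieltjes_self (α t : ℝ) (f g : ℝ → ℝ) : stieltjes α t t f g = 0 := by
  simp [stieltjes]

/-- The constant in the Hölder estimate of the generalized Stieltjes integral. -/
noncomputable def stieltjesConst (α T : ℝ) : ℝ :=
  (3 / (1 - α) + 2 / α) * ((1 + T ^ α) / Real.Gamma (1 - α) * (2 / Real.Gamma α))

theorem stieltjesConst_nonneg (hα : α ∈ Ioo (0 : ℝ) 1) (hT : 0 ≤ T) :
    0 ≤ stieltjesConst α T := by
  have h1 : 0 < Real.Gamma α := Real.Gamma_pos_of_pos hα.1
  have h2 : 0 < Real.Gamma (1 - α) := Real.Gamma_pos_of_pos (by linarith [hα.2])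
  have h3 : 0 < 1 - α := by linarith [hα.2]
  have h4 := hα.1
  rw [stieltjesConst]
  positivity

theorem intervalIntegrable_stieltjes (hα : α ∈ Ioo (0 : ℝ) 1) (f : W1 α 0 T) (g : W2 α T) {t : ℝ}
    (ht : t ∈ Icc 0 T) :
    IntervalIntegrable (fun u => leftFracDeriv α 0 f u * rightFracDerivSub α g t u)
      volume 0 t :=
  intervalIntegrable_mul_of_le hα.2 ht.1
    ((aestronglyMeasurable_leftFracDeriv f).mono_measure (Measure.restrict_mono
      (Ioo_subset_Icc_self.trans (Icc_subset_Icc_right ht.2)) le_rfl))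
    ((aestronglyMeasurable_rightFracDerivSub g ht.2).mono_measure
      (Measure.restrict_mono Ioo_subset_Icc_self le_rfl))
    (fun _ hu => abs_leftFracDeriv_le hα f ⟨hu.1, hu.2.le.trans ht.2⟩)
    (fun _ hu => abs_rightFracDerivSub_le hα g hu.1.le hu.2 ht.2)

theorem abs_stieltjes_sub_le (hα : α ∈ Ioo (0 : ℝ) 1) (f : W1 α 0 T) (g : W2 α T) {s t : ℝ}
    (hs : 0 ≤ s) (hst : s < t) (ht : t ≤ T) :
    |stieltjes α 0 t f g - stieltjes α 0 s f g| ≤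
      stieltjesConst α T * ‖f‖ * ‖g‖ * (t - s) ^ (1 - α) := by
  have h1 : 0 < Real.Gamma α := Real.Gamma_pos_of_pos hα.1
  have h2 : 0 < Real.Gamma (1 - α) := Real.Gamma_pos_of_pos (by linarith [hα.2])
  have hT : 0 ≤ T := hs.trans (hst.le.trans ht)
  -- A single `q` has to serve both the bound on the right derivative (constant `1/Γ(α)`) and that
  -- on its increments (constant `2/Γ(α)`).
  have h := abs_singular_integral_sub_le (T := T) (q := 2 / Real.Gamma α * ‖g‖)
    (a := (1 + T ^ α) / Real.Gamma (1 - α) * ‖f‖) hα.1 hα.2 (by positivity) (by positivity)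
    (aestronglyMeasurable_leftFracDeriv f)
    (fun t ht => aestronglyMeasurable_rightFracDerivSub g ht.2)
    (fun u hu => abs_leftFracDeriv_le hα f hu)
    (fun t ht u hu => (abs_rightFracDerivSub_le hα g hu.1 hu.2 ht.2).trans (by
      gcongr; norm_num))
    (fun t ht s hs u hu => abs_rightFracDerivSub_sub_le hα g hu.1.le hu.2 hs.2 ht.2) hs hst ht
  rw [stieltjes_eq, stieltjes_eq, neg_sub_neg, abs_sub_comm]
  refine h.trans (le_of_eq ?_)
  rw [stieltjesConst]
  ring

theorem abs_stieltjes_le (hα : α ∈ Ioo (0 : ℝ) 1) (f : W1 α 0 T) (g : W2 α T) {t : ℝ}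
    (ht : t ∈ Icc 0 T) :
    |stieltjes α 0 t f g| ≤ stieltjesConst α T * ‖f‖ * ‖g‖ * T ^ (1 - α) := by
  have hT := ht.1.trans ht.2
  have h0 := stieltjesConst_nonneg hα hT
  rcases ht.1.eq_or_lt with h | h
  · rw [← h, stieltjes_self, abs_zero]
    positivity
  · have := abs_stieltjes_sub_le hα f g le_rfl h ht.2
    rw [stieltjes_self, sub_zero, sub_zero] at this
    have h2 : t ^ (1 - α) ≤ T ^ (1 - α) :=
      Real.rpow_le_rpow ht.1 ht.2 (by linarith [hα.2])
    exact this.trans (by gcongr)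

theorem stieltjes_add_left (hα : α ∈ Ioo (0 : ℝ) 1) (f f' : W1 α 0 T) (g : W2 α T) {t : ℝ}
    (ht : t ∈ Icc 0 T) :
    stieltjes α 0 t (f + f') g = stieltjes α 0 t f g + stieltjes α 0 t f' g := by
  rw [stieltjes_eq, stieltjes_eq, stieltjes_eq, ← neg_add,
    ← intervalIntegral.integral_add (intervalIntegrable_stieltjes hα f g ht)
      (intervalIntegrable_stieltjes hα f' g ht)]
  congr 1
  refine intervalIntegral.integral_congr fun u hu => ?_
  rw [uIcc_of_le ht.1] at hu
  rw [leftFracDeriv_add f f' ⟨hu.1, hu.2.trans ht.2⟩, add_mul]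

theorem stieltjes_smul_left (c : ℝ) (f : W1 α 0 T) (g : ℝ → ℝ) (t : ℝ) :
    stieltjes α 0 t (c • f) g = c * stieltjes α 0 t f g := by
  simp only [stieltjes_eq, leftFracDeriv_smul, mul_assoc, intervalIntegral.integral_const_mul,
    mul_neg]

theorem stieltjes_add_right (hα : α ∈ Ioo (0 : ℝ) 1) (f : W1 α 0 T) (g g' : W2 α T) {t : ℝ}
    (ht : t ∈ Icc 0 T) :
    stieltjes α 0 t f (g + g') = stieltjes α 0 t f g + stieltjes α 0 t f g' := by
  rw [stieltjes_eq, stieltjes_eq, stieltjes_eq, ← neg_add,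
    ← intervalIntegral.integral_add (intervalIntegrable_stieltjes hα f g ht)
      (intervalIntegrable_stieltjes hα f g' ht)]
  congr 1
  refine intervalIntegral.integral_congr fun u hu => ?_
  rw [uIcc_of_le ht.1] at hu
  rw [rightFracDerivSub_add g g' hu.1 hu.2 ht.2, mul_add]

theorem stieltjes_smul_right (c : ℝ) (f : ℝ → ℝ) (g : W2 α T) (t : ℝ) :
    stieltjes α 0 t f (c • g) = c * stieltjes α 0 t f g := by
  simp only [stieltjes_eq, rightFracDerivSub_smul, mul_left_comm _ c,
    intervalIntegral.integral_const_mul, mul_neg]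

/-- The constant in the bound of a `(1-α)`-Hölder function in `W1`. -/
noncomputable def holderConst (α T : ℝ) : ℝ := T ^ (1 - α) + T ^ (1 - 2 * α) / (1 - 2 * α)

theorem holderConst_nonneg (hα : α ∈ Ioo (0 : ℝ) (1 / 2)) (hT : 0 ≤ T) :
    0 ≤ holderConst α T := by
  have : 0 < 1 - 2 * α := by linarith [hα.2]
  rw [holderConst]
  positivity

theorem w1ENorm_le_of_holder_zero (hα : α ∈ Ioo (0 : ℝ) (1 / 2)) (hT : 0 ≤ T) {F : ℝ → ℝ} {C : ℝ}
    (hC : 0 ≤ C) (hM : ∀ u ∈ Icc 0 T, |F u| ≤ C * T ^ (1 - α))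
    (hF : ∀ u ∈ Icc 0 T, ∀ v ∈ Ico 0 u, |F u - F v| ≤ C * (u - v) ^ (1 - α)) :
    w1ENorm α 0 T F ≤ ENNReal.ofReal (C * holderConst α T) := by
  refine (w1ENorm_le_of_holder hα.2 (by positivity) hC hM hF).trans (le_of_eq ?_)
  rw [holderConst, sub_zero]
  ring_nf

theorem w1ENorm_stieltjes_le (hα : α ∈ Ioo (0 : ℝ) (1 / 2)) (hT : 0 ≤ T) (f : W1 α 0 T)
    (g : W2 α T) : w1ENorm α 0 T (fun t => stieltjes α 0 t f g) ≤
      ENNReal.ofReal (stieltjesConst α T * ‖f‖ * ‖g‖ * holderConst α T) := by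
  have hα' : α ∈ Ioo (0 : ℝ) 1 := ⟨hα.1, by linarith [hα.2]⟩
  have h0 := stieltjesConst_nonneg hα' hT
  exact w1ENorm_le_of_holder_zero hα hT (by positivity) (fun u hu => abs_stieltjes_le hα' f g hu)
    fun u hu v hv => abs_stieltjes_sub_le hα' f g hv.1 hv.2 hu.2

/-- The indefinite generalized Stieltjes integral as an element of `W1`. -/
noncomputable def W1.stieltjes (hα : α ∈ Ioo (0 : ℝ) (1 / 2)) (hT : 0 ≤ T) (f : W1 α 0 T)
    (g : W2 α T) : W1 α 0 T :=
  W1.ofFun (fun t => FracDelay.stieltjes α 0 t f g)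
    (aemeasurable_of_holder (β := 1 - α) (by linarith [hα.2]) fun _ hu _ hv =>
      abs_stieltjes_sub_le ⟨hα.1, by linarith [hα.2]⟩ f g hv.1 hv.2 hu.2)
    ((w1ENorm_stieltjes_le hα hT f g).trans_lt ENNReal.ofReal_lt_top)

theorem W1.stieltjes_apply (hα : α ∈ Ioo (0 : ℝ) (1 / 2)) (hT : 0 ≤ T) (f : W1 α 0 T)
    (g : W2 α T) {t : ℝ} (ht : t ∈ Icc 0 T) :
    W1.stieltjes hα hT f g t = FracDelay.stieltjes α 0 t f g :=
  W1.ofFun_apply _ _ ht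

/-- The indefinite generalized Stieltjes integral as a continuous bilinear map. -/
noncomputable def stieltjesCLM (hα : α ∈ Ioo (0 : ℝ) (1 / 2)) (hT : 0 ≤ T) :
    W1 α 0 T →L[ℝ] W2 α T →L[ℝ] W1 α 0 T :=
  have hα' : α ∈ Ioo (0 : ℝ) 1 := ⟨hα.1, by linarith [hα.2]⟩
  LinearMap.mkContinuous₂ (LinearMap.mk₂ ℝ (W1.stieltjes hα hT)
    (fun f f' g => W1.ext fun t ht => by
      simp only [W1.add_apply, W1.stieltjes_apply hα hT _ _ ht]
      exact stieltjes_add_left hα' f f' g ht)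
    (fun c f g => W1.ext fun t ht => by
      simp only [W1.smul_apply, W1.stieltjes_apply hα hT _ _ ht]
      exact stieltjes_smul_left c f g t)
    (fun f g g' => W1.ext fun t ht => by
      simp only [W1.add_apply, W1.stieltjes_apply hα hT _ _ ht]
      exact stieltjes_add_right hα' f g g' ht)
    (fun c f g => W1.ext fun t ht => by
      simp only [W1.smul_apply, W1.stieltjes_apply hα hT _ _ ht]
      exact stieltjes_smul_right c f g t))
    (stieltjesConst α T * holderConst α T) fun f g => by
      have h0 := stieltjesConst_nonneg hα' hT
      have h1 := holderConst_nonneg hα hT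
      exact W1.norm_le _ (by positivity) (fun t ht => W1.stieltjes_apply hα hT f g ht)
        ((w1ENorm_stieltjes_le hα hT f g).trans (le_of_eq (by ring_nf)))

theorem stieltjesCLM_apply (hα : α ∈ Ioo (0 : ℝ) (1 / 2)) (hT : 0 ≤ T) (f : W1 α 0 T)
    (g : W2 α T) {t : ℝ} (ht : t ∈ Icc 0 T) :
    stieltjesCLM hα hT f g t = stieltjes α 0 t f g :=
  W1.stieltjes_apply hα hT f g ht

end Stieltjes

/-! ### Scalar estimates for the Taylor remainder -/

section Scalar

variable {φ : ℝ → ℝ} {C : ℝ}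

theorem abs_sub_le_of_abs_deriv_le {F F' : ℝ → ℝ} {s : Set ℝ} (hs : Convex ℝ s)
    (hF : ∀ x, HasDerivAt F (F' x) x) (hC : ∀ x ∈ s, |F' x| ≤ C) {x y : ℝ} (hx : x ∈ s)
    (hy : y ∈ s) : |F x - F y| ≤ C * |x - y| :=
  hs.norm_image_sub_le_of_norm_hasDerivWithin_le (fun z _ => (hF z).hasDerivWithinAt) hC hy hx

/-- The first two derivatives of `φ` exist everywhere and are bounded by `C`, and the second one
is continuous. -/
structure HasBoundedDerivs (φ : ℝ → ℝ) (C : ℝ) : Prop where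
  hasDerivAt : ∀ x, HasDerivAt φ (deriv φ x) x
  hasDerivAt_deriv : ∀ x, HasDerivAt (deriv φ) (deriv (deriv φ) x) x
  continuous_deriv_deriv : Continuous (deriv (deriv φ))
  abs_deriv_le : ∀ x, |deriv φ x| ≤ C
  abs_deriv_deriv_le : ∀ x, |deriv (deriv φ) x| ≤ C

theorem IsCkb.exists_hasBoundedDerivs (h : IsCkb 2 φ) : ∃ C, HasBoundedDerivs φ C := by
  obtain ⟨hc, hb⟩ := h
  obtain ⟨C₁, h₁⟩ := hb 1 le_rfl one_le_two
  obtain ⟨C₂, h₂⟩ := hb 2 one_le_two le_rfl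
  rw [iteratedDeriv_one] at h₁
  rw [iteratedDeriv_succ, iteratedDeriv_one] at h₂
  have hd : ContDiff ℝ 1 (deriv φ) := by
    have : ContDiff ℝ (1 + 1) φ := by simpa [one_add_one_eq_two] using hc
    exact (contDiff_succ_iff_deriv.1 this).2.2
  refine ⟨max C₁ C₂, fun x => ((hc.differentiable (by norm_num)) x).hasDerivAt,
    fun x => ((hd.differentiable (by norm_num)) x).hasDerivAt, hd.continuous_deriv le_rfl,
    fun x => (h₁ x).trans (le_max_left _ _), fun x => (h₂ x).trans (le_max_right _ _)⟩

theorem HasBoundedDerivs.nonneg (h : HasBoundedDerivs φ C) : 0 ≤ C :=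
  (abs_nonneg _).trans (h.abs_deriv_le 0)

theorem HasBoundedDerivs.continuous (h : HasBoundedDerivs φ C) : Continuous φ :=
  continuous_iff_continuousAt.2 fun x => (h.hasDerivAt x).continuousAt

theorem HasBoundedDerivs.continuous_deriv (h : HasBoundedDerivs φ C) : Continuous (deriv φ) :=
  continuous_iff_continuousAt.2 fun x => (h.hasDerivAt_deriv x).continuousAt

theorem HasBoundedDerivs.abs_sub_le (h : HasBoundedDerivs φ C) (x y : ℝ) :
    |φ x - φ y| ≤ C * |x - y| :=
  abs_sub_le_of_abs_deriv_le convex_univ h.hasDerivAt (fun z _ => h.abs_deriv_le z)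
    (mem_univ x) (mem_univ y)

theorem HasBoundedDerivs.abs_deriv_sub_le (h : HasBoundedDerivs φ C) (x y : ℝ) :
    |deriv φ x - deriv φ y| ≤ C * |x - y| :=
  abs_sub_le_of_abs_deriv_le convex_univ h.hasDerivAt_deriv (fun z _ => h.abs_deriv_deriv_le z)
    (mem_univ x) (mem_univ y)

/-- The remainder of the first-order Taylor expansion. -/
noncomputable def taylorRem (φ : ℝ → ℝ) (a k : ℝ) : ℝ := φ (a + k) - φ a - deriv φ a * k

/-- The derivative in `k` is `φ'(a + k) - φ'(a)`, at most `C m` in absolute value on `[-m, m]`. -/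
theorem HasBoundedDerivs.abs_taylorRem_sub_right_le (h : HasBoundedDerivs φ C) (a : ℝ)
    {k k' m : ℝ} (hk : |k| ≤ m) (hk' : |k'| ≤ m) :
    |taylorRem φ a k - taylorRem φ a k'| ≤ C * m * |k - k'| := by
  refine abs_sub_le_of_abs_deriv_le (F := taylorRem φ a)
    (F' := fun z => deriv φ (a + z) - deriv φ a) (convex_Icc (-m) m) (fun z => ?_)
    (fun z hz => ?_) (abs_le.1 hk) (abs_le.1 hk')
  · have h1 := (h.hasDerivAt (a + z)).comp_const_add a z
    have h2 : HasDerivAt (fun k => deriv φ a * k) (deriv φ a) z := by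
      simpa using (hasDerivAt_id z).const_mul (deriv φ a)
    exact (h1.sub_const _).sub h2
  · refine (h.abs_deriv_sub_le _ _).trans ?_
    rw [add_sub_cancel_left]
    exact mul_le_mul_of_nonneg_left (abs_le.2 hz) h.nonneg

theorem HasBoundedDerivs.abs_taylorRem_le (h : HasBoundedDerivs φ C) (a : ℝ) {k m : ℝ}
    (hk : |k| ≤ m) : |taylorRem φ a k| ≤ C * m * m := by
  have hm := (abs_nonneg k).trans hk
  have h1 := h.abs_taylorRem_sub_right_le a hk (k' := 0) (by simpa using hm)
  rw [show taylorRem φ a 0 = 0 by simp [taylorRem], sub_zero, sub_zero] at h1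
  have := h.nonneg
  exact h1.trans (by gcongr)

/-- The derivative in `a` is `φ'(a + k) - φ'(a) - φ''(a) k`, again a remainder. Boundedness of `φ''`
would only make it `O(|k|)`; uniform continuity of `φ''` on compact sets makes it `o(|k|)`, as
differentiability on `W1` requires. -/
theorem HasBoundedDerivs.exists_abs_taylorRem_sub_left_le (h : HasBoundedDerivs φ C) (R : ℝ)
    {ε : ℝ} (hε : 0 < ε) : ∃ δ > 0, ∀ k, |k| ≤ δ → ∀ a ∈ Icc (-R) R, ∀ a' ∈ Icc (-R) R,
      |taylorRem φ a k - taylorRem φ a' k| ≤ ε * |k| * |a - a'| := by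
  -- The margin `1` keeps `a + k` in the compact interval, since `|k| ≤ 1`.
  have hu := (isCompact_Icc (a := -(R + 1)) (b := R + 1)).uniformContinuousOn_of_continuous
    h.continuous_deriv_deriv.continuousOn
  obtain ⟨δ, hδ, hd⟩ := Metric.uniformContinuousOn_iff_le.1 hu ε hε
  refine ⟨min δ 1, lt_min hδ one_pos, fun k hk a ha a' ha' => ?_⟩
  refine abs_sub_le_of_abs_deriv_le (F := fun z => taylorRem φ z k)
    (F' := fun z => deriv φ (z + k) - deriv φ z - deriv (deriv φ) z * k)
    (convex_Icc (-R) R) (fun z => ?_) (fun z hz => ?_) ha ha'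
  · exact (((h.hasDerivAt (z + k)).comp_add_const z k).sub (h.hasDerivAt z)).sub
      ((h.hasDerivAt_deriv z).mul_const k)
  · have hk1 := abs_le.1 (hk.trans (min_le_right _ _))
    have key := abs_sub_le_of_abs_deriv_le
      (F := fun w => deriv φ (z + w) - deriv (deriv φ) z * w)
      (F' := fun w => deriv (deriv φ) (z + w) - deriv (deriv φ) z) (C := ε)
      (convex_Icc (-|k|) |k|) (fun w => ?_) (fun w hw => ?_)
      (x := k) (y := 0) (abs_le.1 le_rfl) (by simp)
    · simp only [add_zero, mul_zero, sub_zero] at key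
      rwa [sub_right_comm]
    · have h2 : HasDerivAt (fun w => deriv (deriv φ) z * w) (deriv (deriv φ) z) w := by
        simpa using (hasDerivAt_id w).const_mul (deriv (deriv φ) z)
      exact ((h.hasDerivAt_deriv (z + w)).comp_const_add z w).sub h2
    · have hw' : |w| ≤ |k| := abs_le.2 hw
      have hw1 := abs_le.1 (hw'.trans (hk.trans (min_le_right _ _)))
      refine hd (z + w) ⟨by linarith [hz.1], by linarith [hz.2]⟩ z
        ⟨by linarith [hz.1], by linarith [hz.2]⟩ ?_
      rw [Real.dist_eq, add_sub_cancel_left]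
      exact hw'.trans (hk.trans (min_le_left _ _))

end Scalar

/-! ### Superposition operators on `W_1^α` and their derivatives -/

section Nemytskii

variable {α a b C : ℝ} {φ : ℝ → ℝ}

theorem W1.aemeasurable_Icc (f : W1 α a b) : AEMeasurable f (volume.restrict (Icc a b)) := f.2.2.1

theorem HasBoundedDerivs.w1ENorm_comp_lt (h : HasBoundedDerivs φ C) (f : W1 α a b) :
    w1ENorm α a b (fun t => φ (f t)) < ∞ := by
  have h0 := h.nonneg
  refine (w1ENorm_le_of_dominated (M := |φ 0| + C * ‖f‖) f f h0 le_rfl (by positivity)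
    (fun u _ => ?_) (fun u _ v _ => ?_)).trans_lt ENNReal.ofReal_lt_top
  · have h1 := h.abs_sub_le (f u) 0
    rw [sub_zero] at h1
    have h2 : C * |f u| ≤ C * ‖f‖ := mul_le_mul_of_nonneg_left (f.abs_apply_le u) h0
    have h3 := abs_sub_abs_le_abs_sub (φ (f u)) (φ 0)
    linarith
  · rw [zero_mul, add_zero]
    exact h.abs_sub_le _ _

/-- The superposition operator `f ↦ φ ∘ f` on `W1`. -/
noncomputable def nemytskii (h : HasBoundedDerivs φ C) (f : W1 α a b) : W1 α a b :=
  W1.ofFun (fun t => φ (f t)) (h.continuous.measurable.comp_aemeasurable f.aemeasurable_Icc)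
    (h.w1ENorm_comp_lt f)

theorem nemytskii_apply (h : HasBoundedDerivs φ C) (f : W1 α a b) {t : ℝ} (ht : t ∈ Icc a b) :
    nemytskii h f t = φ (f t) :=
  W1.ofFun_apply _ _ ht

theorem HasBoundedDerivs.w1ENorm_deriv_mul_le (h : HasBoundedDerivs φ C) (f k : W1 α a b) :
    w1ENorm α a b (fun t => deriv φ (f t) * k t) ≤
      ENNReal.ofReal ((2 * C + C * ‖f‖) * ‖k‖) := by
  have h0 := h.nonneg
  refine (w1ENorm_le_of_dominated (M := C * ‖k‖) f k (c₁ := C * ‖k‖) (by positivity) h0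
    (by positivity) (fun u _ => ?_) (fun u _ v _ => ?_)).trans (le_of_eq (by ring_nf))
  · rw [abs_mul]
    have h1 := h.abs_deriv_le (f u)
    have h2 := k.abs_apply_le u
    gcongr
  · have h1 := h.abs_deriv_sub_le (f u) (f v)
    have h2 := k.abs_apply_le u
    have h3 := h.abs_deriv_le (f v)
    calc |deriv φ (f u) * k u - deriv φ (f v) * k v|
        = |(deriv φ (f u) - deriv φ (f v)) * k u + deriv φ (f v) * (k u - k v)| := by ring_nf
      _ ≤ |deriv φ (f u) - deriv φ (f v)| * |k u| + |deriv φ (f v)| * |k u - k v| := by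
          rw [← abs_mul, ← abs_mul]; exact abs_add_le _ _
      _ ≤ C * |f u - f v| * ‖k‖ + C * |k u - k v| := by gcongr
      _ = _ := by ring

/-- The product `φ'(f) k` as an element of `W1`. -/
noncomputable def W1.derivMul (h : HasBoundedDerivs φ C) (f k : W1 α a b) : W1 α a b :=
  W1.ofFun (fun t => deriv φ (f t) * k t)
    ((h.continuous_deriv.measurable.comp_aemeasurable f.aemeasurable_Icc).mul k.aemeasurable_Icc)
    ((h.w1ENorm_deriv_mul_le f k).trans_lt ENNReal.ofReal_lt_top)

theorem W1.derivMul_apply (h : HasBoundedDerivs φ C) (f k : W1 α a b) {t : ℝ}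
    (ht : t ∈ Icc a b) : W1.derivMul h f k t = deriv φ (f t) * k t :=
  W1.ofFun_apply _ _ ht

/-- The derivative `k ↦ φ'(f) k` of the superposition operator at `f`. -/
noncomputable def nemytskiiDeriv (h : HasBoundedDerivs φ C) (f : W1 α a b) :
    W1 α a b →L[ℝ] W1 α a b :=
  LinearMap.mkContinuous
    { toFun := W1.derivMul h f
      map_add' := fun k k' => W1.ext fun t ht => by
        simp only [W1.add_apply, W1.derivMul_apply h f _ ht, mul_add]
      map_smul' := fun c k => W1.ext fun t ht => by
        simp only [RingHom.id_apply, W1.smul_apply, W1.derivMul_apply h f _ ht, mul_left_comm] }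
    (2 * C + C * ‖f‖) fun k => by
      have h0 := h.nonneg
      exact W1.norm_le _ (by positivity) (fun t ht => W1.derivMul_apply h f k ht)
        (h.w1ENorm_deriv_mul_le f k)

theorem nemytskiiDeriv_apply (h : HasBoundedDerivs φ C) (f k : W1 α a b) {t : ℝ}
    (ht : t ∈ Icc a b) : nemytskiiDeriv h f k t = deriv φ (f t) * k t :=
  W1.derivMul_apply h f k ht

/-- The error is `t ↦ taylorRem φ (f t) (k t)`. Its increments split through `taylorRem φ (f v) (k
u)`: changing `f` costs `ε ‖k‖ |f u - f v|`, changing `k` costs `C ‖k‖ |k u - k v|`. -/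
theorem hasFDerivAt_nemytskii (h : HasBoundedDerivs φ C) (f : W1 α a b) :
    HasFDerivAt (nemytskii h) (nemytskiiDeriv h f) f := by
  have h0 := h.nonneg
  rw [hasFDerivAt_iff_isLittleO_nhds_zero, Asymptotics.isLittleO_iff]
  intro c hc
  -- This `ε` and the radius `c / (4 (C + 1))` make the three terms of the error at most `c/4`,
  -- `c/2` and `c/4` times `‖k‖`.
  have hε : 0 < c / (2 * (‖f‖ + 1)) := by positivity
  obtain ⟨δ, hδ, hd⟩ := h.exists_abs_taylorRem_sub_left_le ‖f‖ hε
  have hr : 0 < min δ (c / (4 * (C + 1))) := lt_min hδ (by positivity)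
  filter_upwards [Metric.ball_mem_nhds (0 : W1 α a b) hr] with k hk
  rw [mem_ball_zero_iff] at hk
  have hk1 : ‖k‖ ≤ δ := (hk.trans_le (min_le_left _ _)).le
  have hk2 : ‖k‖ ≤ c / (4 * (C + 1)) := (hk.trans_le (min_le_right _ _)).le
  have hf : ∀ u, f u ∈ Icc (-‖f‖) ‖f‖ := fun u => abs_le.1 (f.abs_apply_le u)
  have hle : w1ENorm α a b (fun t => taylorRem φ (f t) (k t)) ≤
      ENNReal.ofReal (C * ‖k‖ * ‖k‖ + c / (2 * (‖f‖ + 1)) * ‖k‖ * ‖f‖ + C * ‖k‖ * ‖k‖) := by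
    refine w1ENorm_le_of_dominated f k (by positivity) (by positivity) (by positivity)
      (fun u _ => h.abs_taylorRem_le _ (k.abs_apply_le u)) (fun u _ v _ => ?_)
    have e1 := hd (k u) ((k.abs_apply_le u).trans hk1) (f u) (hf u) (f v) (hf v)
    have e2 := h.abs_taylorRem_sub_right_le (f v) (k.abs_apply_le u) (k.abs_apply_le v)
    have e3 : c / (2 * (‖f‖ + 1)) * |k u| * |f u - f v| ≤
        c / (2 * (‖f‖ + 1)) * ‖k‖ * |f u - f v| := by
      have := k.abs_apply_le u
      gcongr
    have e4 := abs_sub_le (taylorRem φ (f u) (k u)) (taylorRem φ (f v) (k u))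
      (taylorRem φ (f v) (k v))
    linarith
  have hn : ‖nemytskii h (f + k) - nemytskii h f - nemytskiiDeriv h f k‖ ≤
      C * ‖k‖ * ‖k‖ + c / (2 * (‖f‖ + 1)) * ‖k‖ * ‖f‖ + C * ‖k‖ * ‖k‖ := by
    refine W1.norm_le _ (by positivity) (fun t ht => ?_) hle
    rw [W1.sub_apply, W1.sub_apply, nemytskii_apply h _ ht, nemytskii_apply h _ ht,
      nemytskiiDeriv_apply h _ _ ht, W1.add_apply, taylorRem]
  refine hn.trans ?_
  have b1 : C * ‖k‖ ≤ c / 4 := by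
    rw [le_div_iff₀ (by positivity)] at hk2
    nlinarith [norm_nonneg k]
  have b2 : c / (2 * (‖f‖ + 1)) * ‖f‖ ≤ c / 2 := by
    rw [div_mul_eq_mul_div, div_le_div_iff₀ (by positivity) (by positivity)]
    nlinarith [norm_nonneg f]
  have hk0 := norm_nonneg k
  calc C * ‖k‖ * ‖k‖ + c / (2 * (‖f‖ + 1)) * ‖k‖ * ‖f‖ + C * ‖k‖ * ‖k‖
      = (C * ‖k‖ + c / (2 * (‖f‖ + 1)) * ‖f‖ + C * ‖k‖) * ‖k‖ := by ring
    _ ≤ (c / 4 + c / 2 + c / 4) * ‖k‖ := by gcongr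
    _ = c * ‖k‖ := by ring

end Nemytskii

/-! ### The delay operator -/

section Shift

variable {α r T : ℝ}

theorem w1ENorm_shift (α r T : ℝ) (f : ℝ → ℝ) :
    w1ENorm α 0 T (fun s => f (s - r)) = w1ENorm α (-r) (T - r) f := by
  have key : ∀ u, ∫⁻ v in Ioo 0 u, ‖f (u - r) - f (v - r)‖ₑ / ENNReal.ofReal ((u - v) ^ (α + 1)) =
      ∫⁻ v in Ioo (-r) (u - r), ‖f (u - r) - f v‖ₑ / ENNReal.ofReal ((u - r - v) ^ (α + 1)) := by
    intro u
    have hp := (measurePreserving_sub_right volume r).setLIntegral_comp_preimage_emb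
      (measurableEmbedding_subRight r)
      (fun v => ‖f (u - r) - f v‖ₑ / ENNReal.ofReal ((u - r - v) ^ (α + 1))) (Ioo (-r) (u - r))
    rw [← hp]
    simp only [preimage_sub_const_Ioo, neg_add_cancel, sub_add_cancel, sub_sub_sub_cancel_right]
  refine le_antisymm (iSup₂_le fun u hu => ?_) (iSup₂_le fun u hu => ?_)
  · rw [key u]
    exact le_iSup₂ (f := fun u (_ : u ∈ Icc (-r) (T - r)) => ‖f u‖ₑ +
      ∫⁻ v in Ioo (-r) u, ‖f u - f v‖ₑ / ENNReal.ofReal ((u - v) ^ (α + 1))) (u - r)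
      ⟨by linarith [hu.1], by linarith [hu.2]⟩
  · have h := key (u + r)
    simp only [add_sub_cancel_right] at h
    rw [← h]
    have := le_iSup₂ (f := fun u (_ : u ∈ Icc 0 T) => ‖f (u - r)‖ₑ +
      ∫⁻ v in Ioo 0 u, ‖f (u - r) - f (v - r)‖ₑ / ENNReal.ofReal ((u - v) ^ (α + 1))) (u + r)
      ⟨by linarith [hu.1], by linarith [hu.2]⟩
    simp only [add_sub_cancel_right] at this
    exact this

theorem W1.aemeasurable_shift (f : W1 α (-r) (T - r)) :
    AEMeasurable (fun s => f (s - r)) (volume.restrict (Icc 0 T)) := by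
  have hp := (measurePreserving_sub_right volume r).restrict_preimage_emb
    (measurableEmbedding_subRight r) (Icc (-r) (T - r))
  simp only [preimage_sub_const_Icc, neg_add_cancel, sub_add_cancel] at hp
  have hf := f.aemeasurable_Icc
  rw [← hp.map_eq] at hf
  exact hf.comp_measurable hp.measurable

/-- The delayed function `f(· - r)` as an element of `W1`. -/
noncomputable def W1.shift (f : W1 α (-r) (T - r)) : W1 α 0 T :=
  W1.ofFun (fun s => f (s - r)) f.aemeasurable_shift (by
    rw [w1ENorm_shift, f.w1ENorm_eq]; exact ENNReal.ofReal_lt_top)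

theorem W1.shift_apply (f : W1 α (-r) (T - r)) {t : ℝ} (ht : t ∈ Icc 0 T) :
    f.shift t = f (t - r) :=
  W1.ofFun_apply _ _ ht

/-- The delay operator `f ↦ f(· - r)`. -/
noncomputable def shiftCLM (α r T : ℝ) : W1 α (-r) (T - r) →L[ℝ] W1 α 0 T :=
  LinearMap.mkContinuous
    { toFun := W1.shift
      map_add' := fun f g => W1.ext fun t ht => by
        simp only [W1.add_apply, W1.shift_apply _ ht]
      map_smul' := fun c f => W1.ext fun t ht => by
        simp only [RingHom.id_apply, W1.smul_apply, W1.shift_apply _ ht] }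
    1 fun f => W1.norm_le _ (by positivity) (fun t ht => W1.shift_apply f ht) (by
      rw [w1ENorm_shift, one_mul, f.w1ENorm_eq])

theorem shiftCLM_apply (f : W1 α (-r) (T - r)) {t : ℝ} (ht : t ∈ Icc 0 T) :
    shiftCLM α r T f t = f (t - r) :=
  W1.shift_apply f ht

end Shift

/-! ### Volterra equations and Gronwall's inequality in a weighted sup norm -/

section Volterra

variable {T : ℝ}

theorem exp_neg_mul_integral_exp_le {l : ℝ} (hl : 0 < l) (t : ℝ) :
    Real.exp (-(l * t)) * ∫ s in (0 : ℝ)..t, Real.exp (l * s) ≤ 1 / l := by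
  have h : ∫ s in (0 : ℝ)..t, Real.exp (l * s) = (Real.exp (l * t) - 1) / l := by
    rw [intervalIntegral.integral_comp_mul_left _ hl.ne', integral_exp, mul_zero, Real.exp_zero,
      smul_eq_mul, inv_mul_eq_div]
  rw [h, ← mul_div_assoc, mul_sub, ← Real.exp_add, neg_add_cancel, Real.exp_zero, mul_one]
  have := Real.exp_pos (-(l * t))
  gcongr
  linarith

/-- Existence for a Volterra equation with a Lipschitz nonlinearity that is merely measurable in
time. The map is contracting in the sup norm weighted by `exp (-(2 * L + 1) t)`. -/
theorem exists_volterra_solution (hT : 0 ≤ T) {ψ : ℝ → ℝ → ℝ} {L : ℝ} (hL : 0 ≤ L)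
    (hψ : ∀ s x y, |ψ s x - ψ s y| ≤ L * |x - y|)
    (hint : ∀ w : ℝ → ℝ, Continuous w → IntervalIntegrable (fun s => ψ s (w s)) volume 0 T) :
    ∃ y : ℝ → ℝ, Continuous y ∧ ∀ t ∈ Icc 0 T, y t = ∫ s in (0 : ℝ)..t, ψ s (y s) := by
  -- Then `L / l ≤ 1/2`, and `l > 0` even when `L = 0`.
  set l : ℝ := 2 * L + 1 with hl
  have hl0 : 0 < l := by linarith
  -- The fixed-point unknown is `w(t) = e^(-lt) y(t)`, so the weighted norm of `y` is the ordinary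
  -- sup norm of `w`; `E` recovers `y`.
  let E : C(Icc 0 T, ℝ) → ℝ → ℝ := fun w s => Real.exp (l * s) * IccExtend hT w s
  have hE : ∀ w, Continuous (E w) := fun w =>
    (Real.continuous_exp.comp (continuous_const.mul continuous_id)).mul w.continuous.Icc_extend'
  have hEi : ∀ w, ∀ t ∈ Icc 0 T, IntervalIntegrable (fun s => ψ s (E w s)) volume 0 t :=
    fun w t ht => (hint _ (hE w)).mono_set (by
      rw [uIcc_of_le ht.1, uIcc_of_le hT]; exact Icc_subset_Icc_right ht.2)
  have hcont : ∀ w, ContinuousOn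
      (fun t => Real.exp (-(l * t)) * ∫ s in (0 : ℝ)..t, ψ s (E w s)) (Icc 0 T) := by
    intro w
    refine (Continuous.continuousOn (by fun_prop)).mul ?_
    have := intervalIntegral.continuousOn_primitive_interval' (hint _ (hE w)) left_mem_uIcc
    rwa [uIcc_of_le hT] at this
  let P : C(Icc 0 T, ℝ) → C(Icc 0 T, ℝ) := fun w =>
    ⟨(Icc 0 T).domRestrict fun t => Real.exp (-(l * t)) * ∫ s in (0 : ℝ)..t, ψ s (E w s),
      (hcont w).domRestrict⟩
  have hP : ContractingWith (1 / 2) P := by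
    refine ⟨by rw [← NNReal.coe_lt_coe]; norm_num, LipschitzWith.of_dist_le_mul fun w w' => ?_⟩
    rw [ContinuousMap.dist_le (by positivity)]
    rintro ⟨t, ht⟩
    change dist (Real.exp (-(l * t)) * ∫ s in (0 : ℝ)..t, ψ s (E w s))
      (Real.exp (-(l * t)) * ∫ s in (0 : ℝ)..t, ψ s (E w' s)) ≤ _
    rw [Real.dist_eq, ← mul_sub, ← intervalIntegral.integral_sub (hEi w t ht) (hEi w' t ht),
      abs_mul, abs_of_pos (Real.exp_pos _)]
    have h1 : |∫ s in (0 : ℝ)..t, (ψ s (E w s) - ψ s (E w' s))| ≤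
        L * dist w w' * ∫ s in (0 : ℝ)..t, Real.exp (l * s) := by
      rw [← intervalIntegral.integral_const_mul]
      refine intervalIntegral.norm_integral_le_of_norm_le
        (f := fun s => ψ s (E w s) - ψ s (E w' s)) ht.1 (Filter.Eventually.of_forall fun s _ => ?_)
        (Continuous.intervalIntegrable (μ := volume)
          (u := fun s => L * dist w w' * Real.exp (l * s)) (by fun_prop) _ _)
      refine (hψ s _ _).trans ?_
      rw [← mul_sub, abs_mul, abs_of_pos (Real.exp_pos _)]
      have h2 : |IccExtend hT w s - IccExtend hT w' s| ≤ dist w w' :=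
        ContinuousMap.dist_apply_le_dist (f := w) (g := w') (projIcc 0 T hT s)
      calc L * (Real.exp (l * s) * |IccExtend hT w s - IccExtend hT w' s|)
          ≤ L * (Real.exp (l * s) * dist w w') := by gcongr
        _ = _ := by ring
    have h3 := exp_neg_mul_integral_exp_le hl0 t
    have h4 : L * (1 / l) ≤ 1 / 2 := by
      rw [mul_one_div, div_le_div_iff₀ hl0 two_pos]; linarith
    calc _ ≤ Real.exp (-(l * t)) * (L * dist w w' * ∫ s in (0 : ℝ)..t, Real.exp (l * s)) := by
          gcongr
      _ = L * dist w w' * (Real.exp (-(l * t)) * ∫ s in (0 : ℝ)..t, Real.exp (l * s)) := by ring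
      _ ≤ L * dist w w' * (1 / l) := by gcongr
      _ = L * (1 / l) * dist w w' := by ring
      _ ≤ 1 / 2 * dist w w' := by gcongr
      _ = _ := by norm_num
  obtain ⟨w, hw, -⟩ := hP.exists_fixedPoint 0 (edist_ne_top _ _)
  refine ⟨E w, hE w, fun t ht => ?_⟩
  have h1 : P w ⟨t, ht⟩ = w ⟨t, ht⟩ := by rw [hw]
  change Real.exp (-(l * t)) * (∫ s in (0 : ℝ)..t, ψ s (E w s)) = w ⟨t, ht⟩ at h1
  have h2 : E w t = Real.exp (l * t) * w ⟨t, ht⟩ := by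
    simp only [E, IccExtend_of_mem hT w ht]
  rw [h2, ← h1, ← mul_assoc, ← Real.exp_add, add_neg_cancel, Real.exp_zero, one_mul]

/-- A Gronwall bound for bounded functions. -/
theorem abs_le_of_le_integral_abs (hT : 0 ≤ T) {d : ℝ → ℝ} {L A D : ℝ} (hL : 0 ≤ L)
    (hD : ∀ t ∈ Icc 0 T, |d t| ≤ D) (hd : IntervalIntegrable d volume 0 T)
    (h : ∀ t ∈ Icc 0 T, |d t| ≤ A + L * ∫ s in (0 : ℝ)..t, |d s|) :
    ∀ t ∈ Icc 0 T, |d t| ≤ 2 * A * Real.exp ((2 * L + 1) * T) := by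
  set l : ℝ := 2 * L + 1 with hl
  have hl0 : 0 < l := by linarith
  have hA : 0 ≤ A := by
    have := h 0 ⟨le_rfl, hT⟩
    rw [intervalIntegral.integral_same, mul_zero, add_zero] at this
    exact (abs_nonneg _).trans this
  -- No continuity of `d` is available. Its boundedness makes the weighted supremum `M` finite, and
  -- the hypothesis then gives `M ≤ A + M / 2`.
  set S := (fun t => Real.exp (-(l * t)) * |d t|) '' Icc 0 T with hS
  have hexp : ∀ t ∈ Icc 0 T, Real.exp (-(l * t)) ≤ 1 := fun t ht =>
    Real.exp_le_one_iff.2 (neg_nonpos.2 (mul_nonneg hl0.le ht.1))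
  have hbdd : BddAbove S := ⟨1 * D, by
    rintro _ ⟨t, ht, rfl⟩
    exact mul_le_mul (hexp t ht) (hD t ht) (abs_nonneg _) zero_le_one⟩
  set M := sSup S with hM
  have hle : ∀ t ∈ Icc 0 T, |d t| ≤ M * Real.exp (l * t) := by
    intro t ht
    have h1 : Real.exp (-(l * t)) * |d t| ≤ M := le_csSup hbdd ⟨t, ht, rfl⟩
    rw [Real.exp_neg, inv_mul_le_iff₀ (Real.exp_pos _)] at h1
    linarith
  have hM0 : 0 ≤ M := by
    have h1 := hle 0 ⟨le_rfl, hT⟩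
    rw [mul_zero, Real.exp_zero, mul_one] at h1
    exact (abs_nonneg _).trans h1
  have hM2 : M ≤ 2 * A := by
    have : M ≤ A + M * (1 / 2) := by
      refine csSup_le ((nonempty_Icc.2 hT).image _) ?_
      rintro _ ⟨t, ht, rfl⟩
      have h1 : ∫ s in (0 : ℝ)..t, |d s| ≤ ∫ s in (0 : ℝ)..t, M * Real.exp (l * s) :=
        intervalIntegral.integral_mono_on ht.1
          (hd.abs.mono_set (by
            rw [uIcc_of_le ht.1, uIcc_of_le hT]; exact Icc_subset_Icc_right ht.2))
          (Continuous.intervalIntegrable (by fun_prop) _ _)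
          fun s hs => hle s ⟨hs.1, hs.2.trans ht.2⟩
      rw [intervalIntegral.integral_const_mul] at h1
      have h3 := exp_neg_mul_integral_exp_le hl0 t
      have h4 : L * (1 / l) ≤ 1 / 2 := by
        rw [mul_one_div, div_le_div_iff₀ hl0 two_pos]; linarith
      have h5 := hexp t ht
      calc Real.exp (-(l * t)) * |d t|
          ≤ Real.exp (-(l * t)) * (A + L * (M * ∫ s in (0 : ℝ)..t, Real.exp (l * s))) := by
            gcongr
            exact (h t ht).trans (by gcongr)
        _ = Real.exp (-(l * t)) * A +
            L * M * (Real.exp (-(l * t)) * ∫ s in (0 : ℝ)..t, Real.exp (l * s)) := by ring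
        _ ≤ 1 * A + L * M * (1 / l) := by gcongr
        _ = A + M * (L * (1 / l)) := by ring
        _ ≤ A + M * (1 / 2) := by gcongr
    linarith
  intro t ht
  refine (hle t ht).trans ?_
  have : Real.exp (l * t) ≤ Real.exp (l * T) := Real.exp_le_exp.2 (by gcongr; exact ht.2)
  gcongr

end Volterra

/-! ### The indefinite integral on `W_1^α` -/

section Integral

variable {α T : ℝ}

theorem intervalIntegrable_of_bounded {F : ℝ → ℝ} {M t : ℝ} (ht : t ∈ Icc 0 T)
    (hm : AEMeasurable F (volume.restrict (Icc 0 T))) (hM : ∀ s ∈ Icc 0 T, |F s| ≤ M) :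
    IntervalIntegrable F volume 0 t := by
  rw [intervalIntegrable_iff_integrableOn_Icc_of_le ht.1]
  refine IntegrableOn.mono_set ?_ (Icc_subset_Icc_right ht.2)
  refine Integrable.mono' (g := fun _ => M) (integrable_const M) hm.aestronglyMeasurable ?_
  filter_upwards [ae_restrict_mem measurableSet_Icc] with s hs
  exact hM s hs

theorem abs_primitive_sub_le {F : ℝ → ℝ} {M : ℝ} (hα : 0 < α)
    (hm : AEMeasurable F (volume.restrict (Icc 0 T))) (hM0 : 0 ≤ M)
    (hM : ∀ s ∈ Icc 0 T, |F s| ≤ M) {u v : ℝ} (hu : u ∈ Icc 0 T) (hv : v ∈ Ico 0 u) :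
    |(∫ s in (0 : ℝ)..u, F s) - ∫ s in (0 : ℝ)..v, F s| ≤ M * T ^ α * (u - v) ^ (1 - α) := by
  have hvT : v ∈ Icc 0 T := ⟨hv.1, hv.2.le.trans hu.2⟩
  rw [intervalIntegral.integral_interval_sub_left (intervalIntegrable_of_bounded hu hm hM)
    (intervalIntegrable_of_bounded hvT hm hM)]
  have h1 := intervalIntegral.norm_integral_le_of_norm_le_const (a := v) (b := u) (C := M)
    (f := F) fun s hs => by
      rw [uIoc_of_le hv.2.le] at hs
      exact hM s ⟨hv.1.trans hs.1.le, hs.2.trans hu.2⟩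
  have h2 : 0 < u - v := sub_pos.2 hv.2
  rw [abs_of_pos h2] at h1
  refine h1.trans ?_
  have h3 : u - v = (u - v) ^ α * (u - v) ^ (1 - α) := by
    rw [← Real.rpow_add h2, add_sub_cancel, Real.rpow_one]
  have h4 : (u - v) ^ α ≤ T ^ α := Real.rpow_le_rpow h2.le (by linarith [hu.2, hv.1]) hα.le
  calc M * (u - v) = M * ((u - v) ^ α * (u - v) ^ (1 - α)) := by rw [← h3]
    _ ≤ M * (T ^ α * (u - v) ^ (1 - α)) := by gcongr
    _ = _ := by ring

theorem w1ENorm_primitive_le (hα : α ∈ Ioo (0 : ℝ) (1 / 2)) (hT : 0 ≤ T) {F : ℝ → ℝ} {M : ℝ}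
    (hm : AEMeasurable F (volume.restrict (Icc 0 T))) (hM0 : 0 ≤ M)
    (hM : ∀ s ∈ Icc 0 T, |F s| ≤ M) :
    w1ENorm α 0 T (fun t => ∫ s in (0 : ℝ)..t, F s) ≤
      ENNReal.ofReal (T ^ α * holderConst α T * M) := by
  refine (w1ENorm_le_of_holder_zero hα hT (C := M * T ^ α) (by positivity) (fun u hu => ?_)
    fun u hu v hv => abs_primitive_sub_le hα.1 hm hM0 hM hu hv).trans (le_of_eq (by ring_nf))
  rcases hu.1.eq_or_lt with rfl | h
  · rw [intervalIntegral.integral_same, abs_zero]; positivity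
  · have h1 := abs_primitive_sub_le hα.1 hm hM0 hM hu (v := 0) ⟨le_rfl, h⟩
    rw [intervalIntegral.integral_same, sub_zero, sub_zero] at h1
    have : u ^ (1 - α) ≤ T ^ (1 - α) := Real.rpow_le_rpow hu.1 hu.2 (by linarith [hα.2])
    exact h1.trans (by gcongr)

/-- The indefinite integral of a bounded measurable function as an element of `W1`. -/
noncomputable def W1.primitive (hα : α ∈ Ioo (0 : ℝ) (1 / 2)) (hT : 0 ≤ T) {F : ℝ → ℝ} {M : ℝ}
    (hm : AEMeasurable F (volume.restrict (Icc 0 T))) (hM0 : 0 ≤ M)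
    (hM : ∀ s ∈ Icc 0 T, |F s| ≤ M) : W1 α 0 T :=
  W1.ofFun (fun t => ∫ s in (0 : ℝ)..t, F s)
    (aemeasurable_of_holder (β := 1 - α) (by linarith [hα.2])
      fun _ hu _ hv => abs_primitive_sub_le hα.1 hm hM0 hM hu hv)
    ((w1ENorm_primitive_le hα hT hm hM0 hM).trans_lt ENNReal.ofReal_lt_top)

theorem W1.primitive_apply (hα : α ∈ Ioo (0 : ℝ) (1 / 2)) (hT : 0 ≤ T) {F : ℝ → ℝ} {M : ℝ}
    (hm : AEMeasurable F (volume.restrict (Icc 0 T))) (hM0 : 0 ≤ M)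
    (hM : ∀ s ∈ Icc 0 T, |F s| ≤ M) {t : ℝ} (ht : t ∈ Icc 0 T) :
    W1.primitive hα hT hm hM0 hM t = ∫ s in (0 : ℝ)..t, F s :=
  W1.ofFun_apply _ _ ht

theorem W1.intervalIntegrable (f : W1 α 0 T) {t : ℝ} (ht : t ∈ Icc 0 T) :
    IntervalIntegrable f volume 0 t :=
  intervalIntegrable_of_bounded ht f.aemeasurable_Icc fun s _ => f.abs_apply_le s

/-- The indefinite integral as a continuous linear operator. -/
noncomputable def integralCLM (hα : α ∈ Ioo (0 : ℝ) (1 / 2)) (hT : 0 ≤ T) :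
    W1 α 0 T →L[ℝ] W1 α 0 T :=
  have key : ∀ f : W1 α 0 T, ∀ t ∈ Icc 0 T,
      W1.primitive hα hT f.aemeasurable_Icc (norm_nonneg f) (fun s _ => f.abs_apply_le s) t =
        ∫ s in (0 : ℝ)..t, f s := fun f t ht => W1.primitive_apply hα hT _ _ _ ht
  LinearMap.mkContinuous
    { toFun := fun f =>
        W1.primitive hα hT f.aemeasurable_Icc (norm_nonneg f) (fun s _ => f.abs_apply_le s)
      map_add' := fun f g => W1.ext fun t ht => by
        rw [W1.add_apply, key _ t ht, key _ t ht, key _ t ht,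
          ← intervalIntegral.integral_add (f.intervalIntegrable ht) (g.intervalIntegrable ht)]
        rfl
      map_smul' := fun c f => W1.ext fun t ht => by
        rw [RingHom.id_apply, W1.smul_apply, key _ t ht, key _ t ht,
          ← intervalIntegral.integral_const_mul]
        rfl }
    (T ^ α * holderConst α T) fun f => by
      have := holderConst_nonneg hα hT
      exact W1.norm_le _ (by positivity) (key f)
        (w1ENorm_primitive_le hα hT f.aemeasurable_Icc (norm_nonneg f)
          fun s _ => f.abs_apply_le s)

theorem integralCLM_apply (hα : α ∈ Ioo (0 : ℝ) (1 / 2)) (hT : 0 ≤ T) (f : W1 α 0 T) {t : ℝ}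
    (ht : t ∈ Icc 0 T) : integralCLM hα hT f t = ∫ s in (0 : ℝ)..t, f s :=
  W1.primitive_apply hα hT f.aemeasurable_Icc (norm_nonneg f) (fun s _ => f.abs_apply_le s) ht

/-- The smoothing effect: only the sup norm of `f` enters, since primitives of bounded functions are
Lipschitz. This lifts sup-norm Gronwall bounds to `W1`. -/
theorem norm_integralCLM_le (hα : α ∈ Ioo (0 : ℝ) (1 / 2)) (hT : 0 ≤ T) (f : W1 α 0 T) {M : ℝ}
    (hM0 : 0 ≤ M) (hM : ∀ s ∈ Icc 0 T, |f s| ≤ M) :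
    ‖integralCLM hα hT f‖ ≤ T ^ α * holderConst α T * M := by
  have := holderConst_nonneg hα hT
  exact W1.norm_le _ (by positivity) (fun t ht => integralCLM_apply hα hT f ht)
    (w1ENorm_primitive_le hα hT f.aemeasurable_Icc hM0 hM)

end Integral

/-! ### Bijectivity of the Volterra operator on `W_1^α` -/

section VolterraOperator

variable {α T : ℝ}

/-- `N` is the superposition operator `x ↦ ψ(·, x(·))` of a function `ψ` that is Lipschitz in its
second variable. -/
structure IsSuperposition (N : W1 α 0 T → W1 α 0 T) (ψ : ℝ → ℝ → ℝ) (L M : ℝ) : Prop where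
  apply_eq : ∀ x, ∀ t ∈ Icc 0 T, N x t = ψ t (x t)
  lipschitz : ∀ t x y, |ψ t x - ψ t y| ≤ L * |x - y|
  bound : ∀ t, |ψ t 0| ≤ M
  measurable : ∀ w : ℝ → ℝ, AEMeasurable w (volume.restrict (Icc 0 T)) →
    AEMeasurable (fun s => ψ s (w s)) (volume.restrict (Icc 0 T))

variable {N : W1 α 0 T → W1 α 0 T} {ψ : ℝ → ℝ → ℝ} {L M : ℝ}

theorem IsSuperposition.nonneg (h : IsSuperposition N ψ L M) : 0 ≤ L := by
  simpa using (abs_nonneg _).trans (h.lipschitz 0 1 0)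

/-- The operator `x ↦ x - ∫_0^· N(x)(s) ds`. -/
noncomputable def volterra (hα : α ∈ Ioo (0 : ℝ) (1 / 2)) (hT : 0 ≤ T)
    (N : W1 α 0 T → W1 α 0 T) (x : W1 α 0 T) : W1 α 0 T :=
  x - integralCLM hα hT (N x)

theorem volterra_apply (hα : α ∈ Ioo (0 : ℝ) (1 / 2)) (hT : 0 ≤ T) (x : W1 α 0 T)
    {t : ℝ} (ht : t ∈ Icc 0 T) : volterra hα hT N x t = x t - ∫ s in (0 : ℝ)..t, N x s := by
  rw [volterra, W1.sub_apply, integralCLM_apply hα hT _ ht]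

/-- The inverse Lipschitz constant of the Volterra operator. -/
noncomputable def volterraConst (α T L : ℝ) : ℝ :=
  1 + T ^ α * holderConst α T * (L * (2 * Real.exp ((2 * L + 1) * T)))

theorem volterraConst_nonneg (hα : α ∈ Ioo (0 : ℝ) (1 / 2)) (hT : 0 ≤ T) (hL : 0 ≤ L) :
    0 ≤ volterraConst α T L := by
  have := holderConst_nonneg hα hT
  rw [volterraConst]
  positivity

/-- With `G` the difference of the images, `x - y = G + ∫ (N x - N y)`. Gronwall bounds `x - y` in
sup norm by `‖G‖`; the Lipschitz bound on `ψ` and the smoothing of the integral then control the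
`W1` norm. -/
theorem IsSuperposition.norm_sub_le (hα : α ∈ Ioo (0 : ℝ) (1 / 2)) (hT : 0 ≤ T)
    (h : IsSuperposition N ψ L M) (x y : W1 α 0 T) :
    ‖x - y‖ ≤ volterraConst α T L * ‖volterra hα hT N x - volterra hα hT N y‖ := by
  set G := volterra hα hT N x - volterra hα hT N y with hG
  have hL := h.nonneg
  have hsub : x - y = G + integralCLM hα hT (N x - N y) := by
    rw [hG, volterra, volterra, map_sub]
    abel
  have hN : ∀ t ∈ Icc 0 T, |(N x - N y) t| ≤ L * |(x - y) t| := fun t ht => by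
    rw [W1.sub_apply, W1.sub_apply, h.apply_eq x t ht, h.apply_eq y t ht]
    exact h.lipschitz t _ _
  have hb := abs_le_of_le_integral_abs hT (A := ‖G‖) hL
    (fun t _ => (x - y).abs_apply_le t) ((x - y).intervalIntegrable ⟨hT, le_rfl⟩)
    fun t ht => by
      have e1 : (x - y) t = G t + ∫ s in (0 : ℝ)..t, (N x - N y) s := by
        rw [← integralCLM_apply hα hT _ ht, ← W1.add_apply, ← hsub]
      have e2 : |∫ s in (0 : ℝ)..t, (N x - N y) s| ≤ ∫ s in (0 : ℝ)..t, L * |(x - y) s| :=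
        intervalIntegral.norm_integral_le_of_norm_le (f := fun s => (N x - N y) s)
          (g := fun s => L * |(x - y) s|) ht.1 (Filter.Eventually.of_forall fun s hs => hN s ⟨hs.1.le, hs.2.trans ht.2⟩)
          (((x - y).intervalIntegrable ht).abs.const_mul L)
      rw [intervalIntegral.integral_const_mul] at e2
      rw [e1]
      exact (abs_add_le _ _).trans (add_le_add (G.abs_apply_le t) e2)
  have hJ := norm_integralCLM_le hα hT (N x - N y)
    (M := L * (2 * ‖G‖ * Real.exp ((2 * L + 1) * T))) (by positivity)
    fun s hs => (hN s hs).trans (mul_le_mul_of_nonneg_left (hb s hs) hL)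
  calc ‖x - y‖ = ‖G + integralCLM hα hT (N x - N y)‖ := by rw [hsub]
    _ ≤ ‖G‖ + T ^ α * holderConst α T * (L * (2 * ‖G‖ * Real.exp ((2 * L + 1) * T))) :=
        (norm_add_le _ _).trans (add_le_add le_rfl hJ)
    _ = _ := by rw [volterraConst]; ring

theorem IsSuperposition.volterra_injective (hα : α ∈ Ioo (0 : ℝ) (1 / 2)) (hT : 0 ≤ T)
    (h : IsSuperposition N ψ L M) : Function.Injective (volterra hα hT N) := fun x y hxy => by
  have := h.norm_sub_le hα hT x y
  rw [hxy, sub_self, norm_zero, mul_zero] at this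
  exact sub_eq_zero.1 (norm_le_zero_iff.1 this)

theorem IsSuperposition.volterra_surjective (hα : α ∈ Ioo (0 : ℝ) (1 / 2)) (hT : 0 ≤ T)
    (h : IsSuperposition N ψ L M) : Function.Surjective (volterra hα hT N) := by
  intro G
  have hL := h.nonneg
  have hM : 0 ≤ M := (abs_nonneg _).trans (h.bound 0)
  have hbd : ∀ s x, |ψ s x| ≤ M + L * |x| := fun s x => by
    have h1 := h.lipschitz s x 0
    rw [sub_zero] at h1
    have h2 := abs_sub_abs_le_abs_sub (ψ s x) (ψ s 0)
    linarith [h.bound s]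
  have hmeas : ∀ w : ℝ → ℝ, Continuous w →
      AEMeasurable (fun s => ψ s (w s + G s)) (volume.restrict (Icc 0 T)) := fun w hw =>
    h.measurable _ (hw.aemeasurable.add G.aemeasurable_Icc)
  have hbdd : ∀ w : ℝ → ℝ, Continuous w → ∃ K, 0 ≤ K ∧
      ∀ s ∈ Icc 0 T, |ψ s (w s + G s)| ≤ K := by
    intro w hw
    obtain ⟨B, hB⟩ := (isCompact_Icc (a := (0 : ℝ)) (b := T)).exists_bound_of_continuousOn
      hw.continuousOn
    have hle : ∀ s ∈ Icc 0 T, |ψ s (w s + G s)| ≤ M + L * (B + ‖G‖) := fun s hs => by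
      have h1 : |w s + G s| ≤ B + ‖G‖ :=
        (abs_add_le _ _).trans (add_le_add (hB s hs) (G.abs_apply_le s))
      exact (hbd _ _).trans (by gcongr)
    exact ⟨_, (abs_nonneg _).trans (hle 0 ⟨le_rfl, hT⟩), hle⟩
  -- `G` need not be continuous, so neither need the solution `x`; but `y = x - G` is a primitive,
  -- and it is found among continuous functions.
  obtain ⟨y, hy, hyeq⟩ := exists_volterra_solution hT (ψ := fun s x => ψ s (x + G s)) hL
    (fun s x x' => (h.lipschitz s _ _).trans (le_of_eq (by rw [add_sub_add_right_eq_sub])))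
    fun w hw => by
      obtain ⟨K, -, hK⟩ := hbdd w hw
      exact intervalIntegrable_of_bounded ⟨hT, le_rfl⟩ (hmeas w hw) hK
  obtain ⟨K, hK0, hK⟩ := hbdd y hy
  let Y : W1 α 0 T := W1.primitive hα hT (hmeas y hy) hK0 hK
  have hY : ∀ t ∈ Icc 0 T, Y t = y t := fun t ht => by
    rw [hyeq t ht]
    exact W1.primitive_apply hα hT _ _ _ ht
  refine ⟨Y + G, W1.ext fun t ht => ?_⟩
  have hint : ∫ s in (0 : ℝ)..t, N (Y + G) s = y t := by
    rw [hyeq t ht]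
    refine intervalIntegral.integral_congr fun s hs => ?_
    rw [uIcc_of_le ht.1] at hs
    have hs' : s ∈ Icc 0 T := ⟨hs.1, hs.2.trans ht.2⟩
    rw [h.apply_eq _ s hs', W1.add_apply, hY s hs']
  rw [volterra_apply hα hT _ ht, hint, W1.add_apply, hY t ht]
  ring

end VolterraOperator

/-! ### Differentiation rules on a seminormed source -/

section SeminormedCalculus

variable {E F G : Type*} [SeminormedAddCommGroup E] [NormedSpace ℝ E]
  [NormedAddCommGroup F] [NormedSpace ℝ F] [NormedAddCommGroup G] [NormedSpace ℝ G]

theorem isBigO_sub_of_hasFDerivAt {u : E → F} {u' : E →L[ℝ] F} {x : E} (hu : HasFDerivAt u u' x) :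
    (fun y => u y - u x) =O[nhds x] fun y => y - x := by
  have h := hu.isLittleO.isBigO.add (u'.isBigO_sub (nhds x) x)
  simpa using h

theorem tendsto_of_hasFDerivAt {u : E → F} {u' : E →L[ℝ] F} {x : E} (hu : HasFDerivAt u u' x) :
    Filter.Tendsto u (nhds x) (nhds (u x)) := by
  have h0 : Filter.Tendsto (fun y => ‖y - x‖) (nhds x) (nhds 0) := by
    have : Continuous fun y : E => ‖y - x‖ := (continuous_id.sub continuous_const).norm
    simpa using this.tendsto x
  exact tendsto_sub_nhds_zero_iff.1
    ((isBigO_sub_of_hasFDerivAt hu).norm_right.trans_tendsto h0)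

/-- The chain rule, with a seminormed source. -/
theorem hasFDerivAt_comp {u : E → F} {u' : E →L[ℝ] F} {v : F → G} {v' : F →L[ℝ] G} {x : E}
    (hv : HasFDerivAt v v' (u x)) (hu : HasFDerivAt u u' x) :
    HasFDerivAt (fun y => v (u y)) (v'.comp u') x := by
  refine HasFDerivAt.of_isLittleO ?_
  have h1 := (hv.isLittleO.comp_tendsto (tendsto_of_hasFDerivAt hu)).trans_isBigO
    (isBigO_sub_of_hasFDerivAt hu)
  have h2 := (v'.isBigO_comp (fun y => u y - u x - u' (y - x)) (nhds x)).trans_isLittleO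
    hu.isLittleO
  refine (h1.add h2).congr_left fun y => ?_
  simp only [Function.comp_apply, map_sub, ContinuousLinearMap.comp_apply]
  abel

/-- The product rule for `y ↦ B (u y) y`, with a seminormed source. -/
theorem hasFDerivAt_bilinear_apply_self (B : F →L[ℝ] E →L[ℝ] G) {u : E → F} {u' : E →L[ℝ] F}
    {x : E} (hu : HasFDerivAt u u' x) :
    HasFDerivAt (fun y => B (u y) y) ((B.flip x).comp u' + B (u x)) x := by
  refine HasFDerivAt.of_isLittleO ?_
  have h1 := ((B.flip x).isBigO_comp (fun y => u y - u x - u' (y - x)) (nhds x)).trans_isLittleO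
    hu.isLittleO
  -- The error of the product rule is `B (u y - u x - u' (y - x)) x + B (u y - u x) (y - x)`; in the
  -- second term `u y - u x` tends to zero.
  have h2 : (fun y => B (u y - u x) (y - x)) =o[nhds x] fun y => y - x := by
    have h3 : (fun y => B (u y - u x) (y - x)) =O[nhds x]
        fun y => ‖u y - u x‖ * ‖y - x‖ :=
      Asymptotics.IsBigO.of_bound ‖B‖ (Filter.Eventually.of_forall fun y => by
        rw [Real.norm_of_nonneg (by positivity), ← mul_assoc]
        exact B.le_opNorm₂ _ _)
    refine h3.trans_isLittleO ?_
    have h4 : (fun y => ‖u y - u x‖) =o[nhds x] fun _ => (1 : ℝ) := by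
      rw [Asymptotics.isLittleO_one_iff]
      have := (tendsto_sub_nhds_zero_iff.2 (tendsto_of_hasFDerivAt hu)).norm
      simpa using this
    have h5 := h4.mul_isBigO (Asymptotics.isBigO_refl (fun y : E => ‖y - x‖) (nhds x))
    simp only [one_mul] at h5
    exact h5.of_norm_right
  refine (h1.add h2).congr_left fun y => ?_
  simp only [map_sub, ContinuousLinearMap.comp_apply, add_apply,
    sub_apply, ContinuousLinearMap.flip_apply]
  abel

end SeminormedCalculus

/-! ### Differentiability of the inverse Volterra operator -/

section Inverse

variable {α T : ℝ}

/-- A linear superposition operator gives an invertible Volterra operator. -/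
theorem exists_volterra_equiv (hα : α ∈ Ioo (0 : ℝ) (1 / 2)) (hT : 0 ≤ T)
    {A : W1 α 0 T →L[ℝ] W1 α 0 T} {ψ : ℝ → ℝ → ℝ} {L M : ℝ} (h : IsSuperposition A ψ L M) :
    ∃ e : W1 α 0 T ≃L[ℝ] W1 α 0 T, (e : W1 α 0 T →L[ℝ] W1 α 0 T) =
      ContinuousLinearMap.id ℝ (W1 α 0 T) - (integralCLM hα hT).comp A := by
  set V := ContinuousLinearMap.id ℝ (W1 α 0 T) - (integralCLM hα hT).comp A with hV
  have hVv : ∀ x, V x = volterra hα hT A x := fun x => rfl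
  have hbij : Function.Bijective (V : W1 α 0 T →ₗ[ℝ] W1 α 0 T) :=
    ⟨h.volterra_injective hα hT, h.volterra_surjective hα hT⟩
  let e := LinearEquiv.ofBijective (V : W1 α 0 T →ₗ[ℝ] W1 α 0 T) hbij
  -- The inverse is bounded by the Lipschitz estimate applied to `e.symm y` and `0`, not by an open
  -- mapping argument.
  refine ⟨e.toContinuousLinearEquivOfBounds ‖V‖ (volterraConst α T L) (fun x => V.le_opNorm x)
    fun y => ?_, ?_⟩
  · have h1 := h.norm_sub_le hα hT (e.symm y) 0
    rw [← hVv, ← hVv, map_zero, sub_zero, sub_zero] at h1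
    have h2 : V (e.symm y) = y := e.apply_symm_apply y
    rwa [h2] at h1
  · ext x
    rfl

/-- The solution operator of a Volterra equation is Fréchet differentiable, and its derivative
solves the linearized equation. -/
theorem exists_volterra_inverse (hα : α ∈ Ioo (0 : ℝ) (1 / 2)) (hT : 0 ≤ T)
    {N : W1 α 0 T → W1 α 0 T} {ψ : ℝ → ℝ → ℝ} {L M : ℝ} (h : IsSuperposition N ψ L M)
    {N' : W1 α 0 T → W1 α 0 T →L[ℝ] W1 α 0 T} (hN : ∀ x, HasFDerivAt N (N' x) x)
    (hN' : ∀ x, ∃ ψ' L' M', IsSuperposition (N' x) ψ' L' M') :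
    ∃ (S : W1 α 0 T → W1 α 0 T) (S' : W1 α 0 T → W1 α 0 T →L[ℝ] W1 α 0 T),
      (∀ G, volterra hα hT N (S G) = G) ∧ (∀ G, HasFDerivAt S (S' G) G) ∧
      ∀ G k, volterra hα hT (N' (S G)) (S' G k) = k := by
  choose S hS using h.volterra_surjective hα hT
  have hcont : Continuous S := by
    refine (LipschitzWith.of_dist_le_mul (K := (volterraConst α T L).toNNReal)
      fun G G' => ?_).continuous
    rw [dist_eq_norm, dist_eq_norm,
      Real.coe_toNNReal _ (volterraConst_nonneg hα hT h.nonneg)]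
    have := h.norm_sub_le hα hT (S G) (S G')
    rwa [hS, hS] at this
  have he : ∀ G, ∃ e : W1 α 0 T ≃L[ℝ] W1 α 0 T, (e : W1 α 0 T →L[ℝ] W1 α 0 T) =
      ContinuousLinearMap.id ℝ (W1 α 0 T) - (integralCLM hα hT).comp (N' (S G)) := fun G => by
    obtain ⟨ψ', L', M', h'⟩ := hN' (S G)
    exact exists_volterra_equiv hα hT h'
  choose e he using he
  refine ⟨S, fun G => (e G).symm, hS, fun G => ?_, fun G k => ?_⟩
  -- A continuous right inverse of a map with invertible derivative is differentiable, with the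
  -- inverse derivative.
  · refine HasFDerivAt.of_local_left_inverse (f := volterra hα hT N) hcont.continuousAt ?_
      (Filter.Eventually.of_forall hS)
    rw [he]
    exact (hasFDerivAt_id _).sub ((integralCLM hα hT).hasFDerivAt.comp (S G) (hN (S G)))
  · have h1 : (e G : W1 α 0 T →L[ℝ] W1 α 0 T) ((e G).symm k) = k := (e G).apply_symm_apply k
    rw [he] at h1
    exact h1

variable {φ : ℝ → ℝ} {C : ℝ}

theorem isSuperposition_nemytskii (h : HasBoundedDerivs φ C) :
    IsSuperposition (α := α) (T := T) (nemytskii h) (fun _ => φ) C |φ 0| where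
  apply_eq x _ ht := nemytskii_apply h x ht
  lipschitz _ := h.abs_sub_le
  bound _ := le_rfl
  measurable _ hw := h.continuous.measurable.comp_aemeasurable hw

theorem isSuperposition_nemytskiiDeriv (h : HasBoundedDerivs φ C) (x : W1 α 0 T) :
    IsSuperposition (nemytskiiDeriv h x) (fun t y => deriv φ (x t) * y) C 0 where
  apply_eq k _ ht := nemytskiiDeriv_apply h x k ht
  lipschitz t y z := by
    rw [← mul_sub, abs_mul]
    exact mul_le_mul_of_nonneg_right (h.abs_deriv_le _) (abs_nonneg _)
  bound _ := by rw [mul_zero, abs_zero]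
  measurable _ hw :=
    (h.continuous_deriv.measurable.comp_aemeasurable x.aemeasurable_Icc).mul hw

theorem exists_W1_const (α a b c : ℝ) : ∃ f : W1 α a b, ∀ t ∈ Icc a b, f t = c := by
  have h : w1ENorm α a b (fun _ => c) < ∞ :=
    (w1ENorm_le_of_dominated (M := |c|) (0 : W1 α a b) 0 le_rfl le_rfl (abs_nonneg c)
      (fun _ _ => le_rfl) (fun _ _ _ _ => by simp)).trans_lt ENNReal.ofReal_lt_top
  exact ⟨W1.ofFun _ aemeasurable_const h, fun t ht => W1.ofFun_apply _ _ ht⟩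

end Inverse

end FracDelay

/-! ### The delay equation -/

theorem theorem5p1 (α r T : ℝ) (hα : α ∈ Ioo (0 : ℝ) (1 / 2)) (hr : 0 < r) (hT : 0 < T)
    (b σ η : ℝ → ℝ) (hb : FracDelay.IsCkb 2 b) (hσ : FracDelay.IsCkb 2 σ)
    -- a continuously Fréchet differentiable map `g ↦ x̄^g`, with derivative `g ↦ Dxbar g`
    (xbar : FracDelay.W2 α T → FracDelay.W1 α (-r) (T - r))
    (Dxbar : FracDelay.W2 α T → FracDelay.W2 α T →L[ℝ] FracDelay.W1 α (-r) (T - r))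
    (hxbar : ∀ g, HasFDerivAt xbar (Dxbar g) g) (hDxbar : Continuous Dxbar) :
    -- the equation has exactly one solution `x^g` for every `g`
    ∃ x : FracDelay.W2 α T → ℝ → ℝ,
      (∀ g, FracDelay.IsSolution α r T b σ η (xbar g) g (x g)) ∧
      (∀ g y, FracDelay.IsSolution α r T b σ η (xbar g) g y → EqOn y (x g) (Icc (-r) T)) ∧
      -- `X` is the map `g ↦ x^g`, with values in `W_1^α(0,T)`, and `DX g h` is `D_h x^g`
      ∃ (X : FracDelay.W2 α T → FracDelay.W1 α 0 T)
        (DX : FracDelay.W2 α T → FracDelay.W2 α T →L[ℝ] FracDelay.W1 α 0 T),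
        (∀ g, EqOn (X g) (x g) (Icc 0 T)) ∧
        (∀ g, HasFDerivAt X (DX g) g) ∧
        ∀ g h, ∀ t ∈ Icc 0 T, DX g h t =
          (∫ s in (0 : ℝ)..t, deriv b (x g s) * DX g h s)
          + FracDelay.stieltjes α 0 t (fun s => σ (xbar g (s - r))) h
          + FracDelay.stieltjes α 0 t
              (fun s => deriv σ (xbar g (s - r)) * Dxbar g h (s - r)) g := by
  obtain ⟨Cb, hb'⟩ := hb.exists_hasBoundedDerivs
  obtain ⟨Cσ, hσ'⟩ := hσ.exists_hasBoundedDerivs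
  obtain ⟨S, S', hS, hS', hSlin⟩ := FracDelay.exists_volterra_inverse hα hT.le
    (FracDelay.isSuperposition_nemytskii hb') (FracDelay.hasFDerivAt_nemytskii hb')
    fun x => ⟨_, _, _, FracDelay.isSuperposition_nemytskiiDeriv hb' x⟩
  obtain ⟨c, hc⟩ := FracDelay.exists_W1_const α 0 T (η 0)
  let B := FracDelay.stieltjesCLM hα hT.le
  let u : FracDelay.W2 α T → FracDelay.W1 α 0 T := fun g =>
    FracDelay.nemytskii hσ' (FracDelay.shiftCLM α r T (xbar g))
  let u' : FracDelay.W2 α T → FracDelay.W2 α T →L[ℝ] FracDelay.W1 α 0 T := fun g =>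
    (FracDelay.nemytskiiDeriv hσ' (FracDelay.shiftCLM α r T (xbar g))).comp
      ((FracDelay.shiftCLM α r T).comp (Dxbar g))
  have hu : ∀ g, HasFDerivAt u (u' g) g := fun g =>
    FracDelay.hasFDerivAt_comp (FracDelay.hasFDerivAt_nemytskii hσ' _)
      (FracDelay.hasFDerivAt_comp (FracDelay.shiftCLM α r T).hasFDerivAt (hxbar g))
  have hu_apply : ∀ g, EqOn (u g) (fun s => σ (xbar g (s - r))) (Icc 0 T) := fun g t ht => by
    rw [FracDelay.nemytskii_apply hσ' _ ht, FracDelay.shiftCLM_apply _ ht]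
  have hu'_apply : ∀ g h, EqOn (u' g h)
      (fun s => deriv σ (xbar g (s - r)) * Dxbar g h (s - r)) (Icc 0 T) := fun g h t ht => by
    change FracDelay.nemytskiiDeriv hσ' _ (FracDelay.shiftCLM α r T (Dxbar g h)) t = _
    rw [FracDelay.nemytskiiDeriv_apply hσ' _ _ ht, FracDelay.shiftCLM_apply _ ht,
      FracDelay.shiftCLM_apply _ ht]
  have hB : ∀ (f : FracDelay.W1 α 0 T) (f' : ℝ → ℝ) (g : FracDelay.W2 α T),
      EqOn f f' (Icc 0 T) → ∀ t ∈ Icc 0 T, B f g t = FracDelay.stieltjes α 0 t f' g :=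
    fun f f' g hf t ht => by
      rw [FracDelay.stieltjesCLM_apply hα hT.le f g ht]
      exact FracDelay.stieltjes_congr g ht.1
        (hf.mono (Ioc_subset_Icc_self.trans (Icc_subset_Icc_right ht.2)))
  -- `B (u g) g + c` is the driving term, known once `g` is given; `S` solves the Volterra equation
  -- with this right-hand side.
  let X : FracDelay.W2 α T → FracDelay.W1 α 0 T := fun g => S (B (u g) g + c)
  have hX : ∀ g, ∀ t ∈ Icc 0 T, X g t = η 0 + (∫ s in (0 : ℝ)..t, b (X g s)) +
      FracDelay.stieltjes α 0 t (fun s => σ (xbar g (s - r))) g := fun g t ht => by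
    have h1 : FracDelay.volterra hα hT.le (FracDelay.nemytskii hb') (X g) t =
        (B (u g) g + c) t := by rw [hS]
    have h2 : ∫ s in (0 : ℝ)..t, FracDelay.nemytskii hb' (X g) s = ∫ s in (0 : ℝ)..t, b (X g s) :=
      intervalIntegral.integral_congr fun s hs => by
        rw [uIcc_of_le ht.1] at hs
        exact FracDelay.nemytskii_apply hb' _ ⟨hs.1, hs.2.trans ht.2⟩
    rw [FracDelay.volterra_apply hα hT.le _ ht, h2, FracDelay.W1.add_apply, hc t ht,
      hB _ _ g (hu_apply g) t ht] at h1
    linarith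
  have h0T : (0 : ℝ) ∈ Icc 0 T := ⟨le_rfl, hT.le⟩
  -- The two pieces agree at `t = 0`, where both integrals vanish and `X g 0 = η 0`.
  let x : FracDelay.W2 α T → ℝ → ℝ := fun g t => if t ≤ 0 then η t else X g t
  have hx : ∀ g, EqOn (X g) (x g) (Icc 0 T) := fun g t ht => by
    simp only [x]
    split_ifs with h
    · obtain rfl : t = 0 := le_antisymm h ht.1
      rw [hX g 0 h0T, intervalIntegral.integral_same, FracDelay.stieltjes_self]
      ring
    · rfl
  have hbx : ∀ (F : ℝ → ℝ → ℝ) {y z : ℝ → ℝ}, EqOn z y (Icc 0 T) → ∀ t ∈ Icc 0 T,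
      ∫ s in (0 : ℝ)..t, F s (z s) = ∫ s in (0 : ℝ)..t, F s (y s) := fun F y z hyz t ht =>
    intervalIntegral.integral_congr fun s hs => by
      rw [uIcc_of_le ht.1] at hs
      simp only [hyz ⟨hs.1, hs.2.trans ht.2⟩]
  refine ⟨x, fun g => ⟨⟨X g, hx g⟩, fun t ht => if_pos ht.2, fun t ht => ?_⟩,
    fun g y hy => ?_, X, fun g => (S' (B (u g) g + c)).comp ((B.flip g).comp (u' g) + B (u g)),
    hx, fun g => ?_, fun g h t ht => ?_⟩
  · rw [← hx g ht, hX g t ht, hbx (fun _ => b) (hx g) t ht]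
  · obtain ⟨z, hz⟩ := hy.mem
    -- Both functions are sent by the Volterra operator to the driving term, so injectivity
    -- identifies them.
    have hzX : z = X g := by
      refine (FracDelay.isSuperposition_nemytskii hb').volterra_injective hα hT.le ?_
      rw [hS]
      refine FracDelay.W1.ext fun t ht => ?_
      have h2 : ∫ s in (0 : ℝ)..t, FracDelay.nemytskii hb' z s = ∫ s in (0 : ℝ)..t, b (z s) :=
        intervalIntegral.integral_congr fun s hs => by
          rw [uIcc_of_le ht.1] at hs
          exact FracDelay.nemytskii_apply hb' _ ⟨hs.1, hs.2.trans ht.2⟩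
      rw [FracDelay.volterra_apply hα hT.le _ ht, h2, FracDelay.W1.add_apply, hc t ht,
        hB _ _ g (hu_apply g) t ht, hz ht, hy.eqn t ht, hbx (fun _ => b) hz t ht]
      ring
    intro t ht
    rcases le_total t 0 with h | h
    · rw [hy.init t ⟨ht.1, h⟩]
      exact (if_pos h).symm
    · rw [← hz ⟨h, ht.2⟩, hzX, hx g ⟨h, ht.2⟩]
  · have hSc : HasFDerivAt (fun f => S (f + c)) (S' (B (u g) g + c)) (B (u g) g) :=
      (hS' _).comp (B (u g) g) ((hasFDerivAt_id (𝕜 := ℝ) (B (u g) g)).add_const c)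
    exact FracDelay.hasFDerivAt_comp (u := fun g => B (u g) g) hSc
      (FracDelay.hasFDerivAt_bilinear_apply_self B (hu g))
  -- `k` is the derivative of the driving term in the direction `h`. By `hSlin`, applying the
  -- derivative of `S` to `k` solves the linearized Volterra equation with right-hand side `k`.
  · set k := ((B.flip g).comp (u' g) + B (u g)) h with hk
    have hkt : k t = FracDelay.stieltjes α 0 t
        (fun s => deriv σ (xbar g (s - r)) * Dxbar g h (s - r)) g +
        FracDelay.stieltjes α 0 t (fun s => σ (xbar g (s - r))) h := by
      rw [← hB _ _ g (hu'_apply g h) t ht, ← hB _ _ h (hu_apply g) t ht]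
      rfl
    change S' (B (u g) g + c) k t =
      (∫ s in (0 : ℝ)..t, deriv b (x g s) * S' (B (u g) g + c) k s) + _ + _
    have h1 : FracDelay.volterra hα hT.le (FracDelay.nemytskiiDeriv hb' (X g))
        (S' (B (u g) g + c) k) t = k t := by rw [hSlin]
    have h2 : ∫ s in (0 : ℝ)..t,
        FracDelay.nemytskiiDeriv hb' (X g) (S' (B (u g) g + c) k) s =
        ∫ s in (0 : ℝ)..t, deriv b (X g s) * S' (B (u g) g + c) k s :=
      intervalIntegral.integral_congr fun s hs => by
        rw [uIcc_of_le ht.1] at hs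
        exact FracDelay.nemytskiiDeriv_apply hb' _ _ ⟨hs.1, hs.2.trans ht.2⟩
    rw [FracDelay.volterra_apply hα hT.le _ ht, h2, hkt,
      hbx (fun s y => deriv b y * S' (B (u g) g + c) k s) (hx g) t ht] at h1
    linarith
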